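/- Setting. Let $\mathbf k$ be a field of characteristic $0$ and $A=(a_1,\dots,a_n)=(a_{ij})$ a $d\times n$ integer matrix of rank $d$ whose columns all lie on one hyperplane of $\mathbf Q^d$ not containing the origin; let $\beta\in\mathbf k^d$. Let $I_A=\langle\partial^u-\partial^v : u,v\in\mathbf N^n,\ Au=Av\rangle\subset\mathbf k[\partial_1,\dots,\partial_n]$ be the toric ideal, $D=\mathbf k\langle x_1,\dots,x_n,\partial_1,\dots,\partial_n\rangle$ the Weyl algebra, and $H_A(\beta)$ the left ideal of $D$ generated by $I_A$ and $\sum_j a_{ij}x_j\partial_j-\beta_i$ ($1\le i\le d$); put $M_A(\beta)=D/H_A(\beta)$ and $L=\{u\in\mathbf Z^n: Au=0\}$. Let $w\in\mathbf R^n$ be generic: $w\ne0$ and the initial ideal $\mathrm{in}_w(I_A)$ is a monomial ideal. Let $\Delta_w$ be the regular triangulation of $\mathrm{conv}(A)$ determined by $w$: a set $I\subset\{1,\dots,n\}$ is the vertex set of a face of $\Delta_w$ (the empty face included) if and only if there is $c\in\mathbf R^d$ with $c\cdot a_i=w_i$ for $i\in I$ and $c\cdot a_j<w_j$ for $j\notin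 I$. Series. A formal series annihilated by $H_A(\beta)$ (a solution of $M_A(\beta)$, or $A$-hypergeometric series) of the form $x^v\sum_{u\in L}g_u(\log x)x^u$, $v\in\mathbf k^n$, $g_u\in\mathbf k[y_1,\dots,y_n]$, is in the direction of $w$ if there is a basis $u^{(1)},\dots,u^{(n)}$ of $\mathbf Q^n$ with $w\cdot u^{(j)}>0$ for all $j$ such that $g_u=0$ whenever $u\notin\sum_j\mathbf Q_{\ge0}u^{(j)}$. If moreover $g_0\neq0$, then $x^v\cdot\mathrm{in}_\prec(g_0)(\log x)$, where $\mathrm{in}_\prec$ is the initial monomial for the lexicographic order $\prec$, is called a starting monomial. Such a series (in the direction of $w$, with $g_0\ne0$) is canonical with respect to $w$ if no starting monomial, of any $A$-hypergeometric series in the direction of $w$, other than $x^v\cdot\mathrm{in}_\prec(g_0)(\log x)$ appears in it. It is logarithm-free if all $g_u$ are constants. For $v\in\mathbf k^n$ put $\mathrm{nsupp}(v)=\{j: v_j\in\mathbf Z_{<0}\}$; $v$ has minimal negative support if $\mathrm{nsupp}(v)$ is minimal with respect to inclusion among the sets $\mathrm{nsupp}(v+u)$, $u\in L$. For $v$ with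 $Av=\beta$ and minimal negative support put $$\phi_v=x^v\sum_{u\in N_v}\frac{[v]_{u_-}}{[v+u]_{u_+}}x^u,\qquad N_v=\{u\in L:\mathrm{nsupp}(v+u)=\mathrm{nsupp}(v)\},$$ where $u=u_+-u_-$ with $u_\pm\in\mathbf N^n$ of disjoint supports and $[v]_t=\prod_j v_j(v_j-1)\cdots(v_j-t_j+1)$. Theorem. Let $\tau$ be a face of the cone $\mathbf Q_{\ge0}A$, and let $I=\mathrm{vert}(\tau')$ be the vertex set of a face $\tau'\in\Delta_w$ with $\mathbf Q\tau=\sum_{i\in I}\mathbf Q a_i$. Let $\mathbf Z(A\cap\tau)$ and $\mathbf k(A\cap\tau)$ be the group and the $\mathbf k$-vector space generated by the $a_j\in\tau$, and $$E_\tau(\beta)=\{\lambda\in\mathbf k(A\cap\tau)/\mathbf Z(A\cap\tau):\ \beta-\lambda\in\mathbf N A+\mathbf Z(A\cap\tau)\}.$$ Then $E_\tau(\beta)$ is finite, $\sum_{i\in I}\mathbf Z a_i$ is a subgroup of finite index of $\mathbf Z(A\cap\tau)$, and there exist at least $$|E_\tau(\beta)|\cdot\Big[\mathbf Z(A\cap\tau):\sum_{i\in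 I}\mathbf Z a_i\Big]$$ linearly independent logarithm-free canonical series solutions $\phi_v$ to $M_A(\beta)$ with respect to $w$, with $v\in\mathbf k^n$, $Av=\beta$, of minimal negative support, such that (the class of) $\sum_{a_j\in\tau}v_ja_j$ lies in $E_\tau(\beta)$, $\mathrm{nsupp}(v)\subset I$, and $\{j: v_j\notin\mathbf Z\}\subset I$. -/

import Mathlib

noncomputable section

namespace AHypergeometric

/-! ### The configuration and its cone -/

/-- The `j`-th column `a_j` of `A`, with its entries read in the ring `R`. -/
def col (R : Type*) [Ring R] {d n : ℕ} (A : Matrix (Fin d) (Fin n) ℤ) (j : Fin n) : Fin d → R :=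
  fun i => (A i j : R)

/-- All columns of `A` lie on one hyperplane `h = 1` that misses the origin. -/
def OnHyperplane {d n : ℕ} (A : Matrix (Fin d) (Fin n) ℤ) : Prop :=
  ∃ h : Fin d → ℚ, ∀ j, ∑ i, h i * (A i j : ℚ) = 1

/-- The cone `ℚ≥0 A` in `ℚ^d`. -/
def cone {d n : ℕ} (A : Matrix (Fin d) (Fin n) ℤ) : PointedCone ℚ (Fin d → ℚ) :=
  PointedCone.hull ℚ (Set.range (col ℚ A))

/-- The index set `{j : a_j ∈ τ}` of `A ∩ τ`. -/
def indicesIn {d n : ℕ} (A : Matrix (Fin d) (Fin n) ℤ) (τ : PointedCone ℚ (Fin d → ℚ)) :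
    Set (Fin n) :=
  {j | col ℚ A j ∈ τ}

/-- The lattice `∑_{j ∈ J} ℤ a_j`, inside `k^d`. -/
def latticeOf (k : Type*) [Field k] {d n : ℕ} (A : Matrix (Fin d) (Fin n) ℤ) (J : Set (Fin n)) :
    AddSubgroup (Fin d → k) :=
  AddSubgroup.closure (col k A '' J)

/-- The vector space `∑_{j ∈ J} k a_j`, inside `k^d`. -/
def spaceOf (k : Type*) [Field k] {d n : ℕ} (A : Matrix (Fin d) (Fin n) ℤ) (J : Set (Fin n)) :
    Submodule k (Fin d → k) :=
  Submodule.span k (col k A '' J)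

/-- The monoid `ℕA`, inside `k^d`. -/
def monoidOf (k : Type*) [Field k] {d n : ℕ} (A : Matrix (Fin d) (Fin n) ℤ) :
    AddSubmonoid (Fin d → k) :=
  AddSubmonoid.closure (Set.range (col k A))

/-- `E_τ(β)`: the classes `λ ∈ k(A ∩ τ) / ℤ(A ∩ τ)` with `β - λ ∈ ℕA + ℤ(A ∩ τ)`. The group
`k(A ∩ τ) / ℤ(A ∩ τ)` is regarded as a subgroup of `k^d / ℤ(A ∩ τ)`. -/
def E {k : Type*} [Field k] {d n : ℕ} (A : Matrix (Fin d) (Fin n) ℤ) (β : Fin d → k)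
    (τ : PointedCone ℚ (Fin d → ℚ)) : Set ((Fin d → k) ⧸ latticeOf k A (indicesIn A τ)) :=
  {q | ∃ l ∈ spaceOf k A (indicesIn A τ), QuotientAddGroup.mk l = q ∧
    ∃ m ∈ monoidOf k A, ∃ z ∈ latticeOf k A (indicesIn A τ), β - l = m + z}

/-- `A v = ∑_j v_j a_j` for `v ∈ k^n`. -/
def applyA {k : Type*} [Field k] {d n : ℕ} (A : Matrix (Fin d) (Fin n) ℤ) (v : Fin n → k) :
    Fin d → k :=
  ∑ j, v j • col k A j

open Classical in
/-- The vector `∑_{a_j ∈ τ} v_j a_j`. -/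
def partialSum {k : Type*} [Field k] {d n : ℕ} (A : Matrix (Fin d) (Fin n) ℤ)
    (τ : PointedCone ℚ (Fin d → ℚ)) (v : Fin n → k) : Fin d → k :=
  ∑ j with j ∈ indicesIn A τ, v j • col k A j

/-- `L = {u ∈ ℤ^n : A u = 0}`. -/
def L {d n : ℕ} (A : Matrix (Fin d) (Fin n) ℤ) : AddSubgroup (Fin n → ℤ) :=
  (Matrix.toLin' A).ker.toAddSubgroup

/-! ### Toric ideal, initial ideal, generic weights, regular triangulation -/

/-- The toric ideal `I_A` in `k[∂_1, …, ∂_n]`. -/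
def toricIdeal (k : Type*) [Field k] {d n : ℕ} (A : Matrix (Fin d) (Fin n) ℤ) :
    Ideal (MvPolynomial (Fin n) k) :=
  Ideal.span {p | ∃ u v : Fin n →₀ ℕ,
    (∀ i, ∑ j, A i j * (u j : ℤ) = ∑ j, A i j * (v j : ℤ)) ∧
    p = MvPolynomial.monomial u 1 - MvPolynomial.monomial v 1}

/-- The weight `w · m` of the monomial `∂^m`. -/
def weight {n : ℕ} (w : Fin n → ℝ) (m : Fin n →₀ ℕ) : ℝ := ∑ j, w j * (m j : ℝ)

open Classical in
/-- The initial form `in_w(f)`: the sum of the terms of `f` of maximal `w`-weight. -/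
def initialForm {k : Type*} [Field k] {n : ℕ} (w : Fin n → ℝ) (f : MvPolynomial (Fin n) k) :
    MvPolynomial (Fin n) k :=
  ∑ m ∈ f.support with ∀ m' ∈ f.support, weight w m' ≤ weight w m,
    MvPolynomial.monomial m (f.coeff m)

/-- The initial ideal `in_w(J)`. -/
def initialIdeal {k : Type*} [Field k] {n : ℕ} (w : Fin n → ℝ)
    (J : Ideal (MvPolynomial (Fin n) k)) : Ideal (MvPolynomial (Fin n) k) :=
  Ideal.span (initialForm w '' (J : Set (MvPolynomial (Fin n) k)))

/-- The weight vector `w` is generic: it is nonzero and `in_w(I_A)` is a monomial ideal. -/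
def IsGeneric (k : Type*) [Field k] {d n : ℕ} (A : Matrix (Fin d) (Fin n) ℤ)
    (w : Fin n → ℝ) : Prop :=
  w ≠ 0 ∧ ∃ S : Set (Fin n →₀ ℕ), initialIdeal w (toricIdeal k A) =
    Ideal.span ((fun m => MvPolynomial.monomial m (1 : k)) '' S)

/-- The regular triangulation `Δ_w` of `conv(A)`, each face being given by the index set of its
vertices: `σ` is a face if some linear form `c` on `ℝ^d` satisfies `c · a_i = w_i` for `i ∈ σ` and
`c · a_j < w_j` for `j ∉ σ`; that is, the `(a_i, w_i)`, `i ∈ σ`, are the lifted points on a lower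
face of the lifted configuration. (As the `a_j` lie on a hyperplane off the origin, linear forms
and affine functions have the same restrictions to `A`. The empty face is included.) -/
def regularTriangulation {d n : ℕ} (A : Matrix (Fin d) (Fin n) ℤ) (w : Fin n → ℝ) :
    Set (Finset (Fin n)) :=
  {σ | ∃ c : Fin d → ℝ, (∀ i ∈ σ, ∑ l, c l * (A l i : ℝ) = w i) ∧
    ∀ j, j ∉ σ → ∑ l, c l * (A l j : ℝ) < w j}

/-! ### Formal series with logarithms and the Weyl algebra -/

/-- Formal series `∑_α x^α g_α(log x)`, `α ∈ k^n`, with `g_α ∈ k[y_1, …, y_n]` evaluated at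
`y_i = log x_i`: such a series is the family of its coefficients `α ↦ g_α`. -/
abbrev LogSeries (k : Type*) [Field k] (n : ℕ) : Type _ := (Fin n → k) → MvPolynomial (Fin n) k

/-- Multiplication by `x_i`. -/
def mulX (k : Type*) [Field k] {n : ℕ} (i : Fin n) : Module.End k (LogSeries k n) where
  toFun f := fun α => f (α - Pi.single i 1)
  map_add' f g := by
    funext α
    simp only [Pi.add_apply]
  map_smul' c f := by
    funext α
    simp only [Pi.smul_apply, RingHom.id_apply]

/-- Differentiation by `x_i`:
`∂_i (x^γ g(log x)) = x^(γ - e_i) (γ_i g + ∂g/∂y_i)(log x)`. -/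
def diffX (k : Type*) [Field k] {n : ℕ} (i : Fin n) : Module.End k (LogSeries k n) where
  toFun f := fun α =>
    (α i + 1) • f (α + Pi.single i 1) + MvPolynomial.pderiv i (f (α + Pi.single i 1))
  map_add' f g := by
    funext α
    simp only [Pi.add_apply, smul_add, map_add]
    abel
  map_smul' c f := by
    funext α
    simp only [Pi.smul_apply, smul_add, Derivation.map_smul, RingHom.id_apply, smul_comm c]

/-- The generators of the Weyl algebra. -/
inductive WeylGen (n : ℕ) : Type
  | x (i : Fin n) : WeylGen n
  | del (i : Fin n) : WeylGen n

/-- The defining relations of the Weyl algebra. -/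
inductive WeylRel (k : Type*) [Field k] (n : ℕ) :
    FreeAlgebra k (WeylGen n) → FreeAlgebra k (WeylGen n) → Prop
  | x_comm (i j : Fin n) : WeylRel k n
      (FreeAlgebra.ι k (WeylGen.x i) * FreeAlgebra.ι k (WeylGen.x j))
      (FreeAlgebra.ι k (WeylGen.x j) * FreeAlgebra.ι k (WeylGen.x i))
  | del_comm (i j : Fin n) : WeylRel k n
      (FreeAlgebra.ι k (WeylGen.del i) * FreeAlgebra.ι k (WeylGen.del j))
      (FreeAlgebra.ι k (WeylGen.del j) * FreeAlgebra.ι k (WeylGen.del i))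
  | del_x (i j : Fin n) : WeylRel k n
      (FreeAlgebra.ι k (WeylGen.del i) * FreeAlgebra.ι k (WeylGen.x j))
      (FreeAlgebra.ι k (WeylGen.x j) * FreeAlgebra.ι k (WeylGen.del i) + if i = j then 1 else 0)

/-- The Weyl algebra `D = k⟨x_1, …, x_n, ∂_1, …, ∂_n⟩`. -/
abbrev Weyl (k : Type*) [Field k] (n : ℕ) : Type _ := RingQuot (WeylRel k n)

/-- The element `x_i` of the Weyl algebra. -/
def Weyl.x (k : Type*) [Field k] {n : ℕ} (i : Fin n) : Weyl k n :=
  RingQuot.mkAlgHom k (WeylRel k n) (FreeAlgebra.ι k (WeylGen.x i))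

/-- The element `∂_i` of the Weyl algebra. -/
def Weyl.del (k : Type*) [Field k] {n : ℕ} (i : Fin n) : Weyl k n :=
  RingQuot.mkAlgHom k (WeylRel k n) (FreeAlgebra.ι k (WeylGen.del i))

/-- The operators by which the generators of the Weyl algebra act on formal series. -/
def genAction (k : Type*) [Field k] (n : ℕ) : WeylGen n → Module.End k (LogSeries k n)
  | WeylGen.x i => mulX k i
  | WeylGen.del i => diffX k i

theorem genAction_rel (k : Type*) [Field k] (n : ℕ) ⦃p q : FreeAlgebra k (WeylGen n)⦄
    (h : WeylRel k n p q) :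
    FreeAlgebra.lift k (genAction k n) p = FreeAlgebra.lift k (genAction k n) q := by
  cases h with
  | x_comm i j =>
    simp only [map_mul, FreeAlgebra.lift_ι_apply, genAction]
    ext1 f
    funext α
    simp only [Module.End.mul_apply, mulX, LinearMap.coe_mk, AddHom.coe_mk]
    rw [sub_right_comm]
  | del_comm i j =>
    simp only [map_mul, FreeAlgebra.lift_ι_apply, genAction]
    refine LinearMap.ext fun f => funext fun α => ?_
    simp only [Module.End.mul_apply, diffX, LinearMap.coe_mk, AddHom.coe_mk]
    have hc : MvPolynomial.pderiv i (MvPolynomial.pderiv j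
        (f (α + Pi.single i 1 + Pi.single j 1))) =
        MvPolynomial.pderiv j (MvPolynomial.pderiv i
        (f (α + Pi.single i 1 + Pi.single j 1))) := by
      let D := Derivation k (MvPolynomial (Fin n) k) (MvPolynomial (Fin n) k)
      have h0 : ⁅(MvPolynomial.pderiv i : D), (MvPolynomial.pderiv j : D)⁆ = 0 := by
        refine MvPolynomial.derivation_ext fun l => ?_
        simp only [Derivation.commutator_apply, MvPolynomial.pderiv_X, Derivation.zero_apply]
        by_cases hi : i = l <;> by_cases hj : j = l <;>
          simp [hi, hj, eq_comm]
      have h1 := congrArg (fun P : D => P (f (α + Pi.single i 1 + Pi.single j 1))) h0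
      exact sub_eq_zero.mp h1
    by_cases hij : i = j
    · subst hij; rfl
    · rw [add_right_comm α (Pi.single j 1) (Pi.single i 1)]
      simp only [Pi.add_apply, Pi.single_eq_of_ne hij, Pi.single_eq_of_ne (Ne.symm hij), add_zero,
        map_add, Derivation.map_smul, smul_add, hc, smul_comm (α j + 1) (α i + 1)]
      abel
  | del_x i j =>
    simp only [map_mul, map_add, FreeAlgebra.lift_ι_apply, genAction]
    refine LinearMap.ext fun f => funext fun α => ?_
    by_cases hij : i = j
    · subst hij
      simp only [if_true, map_one, LinearMap.add_apply, Pi.add_apply, Module.End.mul_apply,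
        Module.End.one_apply, diffX, mulX, LinearMap.coe_mk, AddHom.coe_mk, Pi.sub_apply,
        Pi.single_eq_same, add_sub_cancel_right, sub_add_cancel]
      rw [add_smul, one_smul]
      abel
    · simp only [if_neg hij, map_zero, add_zero, Module.End.mul_apply, diffX, mulX,
        LinearMap.coe_mk, AddHom.coe_mk, Pi.sub_apply, Pi.single_eq_of_ne hij, sub_zero,
        sub_add_eq_add_sub]

/-- The action of the Weyl algebra on formal series. -/
def Weyl.act (k : Type*) [Field k] (n : ℕ) : Weyl k n →ₐ[k] Module.End k (LogSeries k n) :=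
  RingQuot.liftAlgHom k ⟨FreeAlgebra.lift k (genAction k n), genAction_rel k n⟩

/-- The operator `∂^m` (the `∂_i` commute, so the order of the factors does not matter). -/
def Weyl.delPow (k : Type*) [Field k] {n : ℕ} (m : Fin n →₀ ℕ) : Weyl k n :=
  ((List.finRange n).map fun i => Weyl.del k i ^ m i).prod

/-- The constant coefficient operator `f(∂)` of a polynomial `f`. -/
def Weyl.ofPoly {k : Type*} [Field k] {n : ℕ} (f : MvPolynomial (Fin n) k) : Weyl k n :=
  ∑ m ∈ f.support, f.coeff m • Weyl.delPow k m

/-- The left ideal `H_A(β)` of the Weyl algebra, generated by `I_A` and the Euler operators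
`∑_j a_ij x_j ∂_j - β_i`. (For a noncommutative ring, `Ideal` means left ideal.) -/
def hypergeometricIdeal {k : Type*} [Field k] {d n : ℕ} (A : Matrix (Fin d) (Fin n) ℤ)
    (β : Fin d → k) : Ideal (Weyl k n) :=
  Ideal.span
    ((Weyl.ofPoly '' (toricIdeal k A : Set (MvPolynomial (Fin n) k))) ∪
      Set.range fun i : Fin d =>
        (∑ j, (A i j : k) • (Weyl.x k j * Weyl.del k j)) - algebraMap k (Weyl k n) (β i))

/-- `f` is a formal solution of `M_A(β) = D / H_A(β)`: it is annihilated by `H_A(β)`. -/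
def IsHypergeometric {k : Type*} [Field k] {d n : ℕ} (A : Matrix (Fin d) (Fin n) ℤ)
    (β : Fin d → k) (f : LogSeries k n) : Prop :=
  ∀ P ∈ hypergeometricIdeal A β, Weyl.act k n P f = 0

/-! ### Canonical series -/

/-- The vector `v + u ∈ k^n` for `v ∈ k^n` and `u ∈ ℤ^n`. -/
def shift {k : Type*} [Field k] {n : ℕ} (v : Fin n → k) (u : Fin n → ℤ) : Fin n → k :=
  fun j => v j + (u j : k)

/-- `f` has the form `x^v ∑_{u ∈ L} g_u(log x) x^u` and is in the direction of `w`: there is a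
basis `u⁽¹⁾, …, u⁽ⁿ⁾` of `ℚ^n` with `w · u⁽ʲ⁾ > 0` such that `g_u = 0` unless
`u ∈ ∑_j ℚ≥0 u⁽ʲ⁾`. -/
def InDirection {k : Type*} [Field k] {d n : ℕ} (A : Matrix (Fin d) (Fin n) ℤ) (w : Fin n → ℝ)
    (v : Fin n → k) (f : LogSeries k n) : Prop :=
  ∃ b : Module.Basis (Fin n) ℚ (Fin n → ℚ), (∀ j, 0 < ∑ i, w i * ((b j i : ℚ) : ℝ)) ∧
    ∀ α, f α ≠ 0 → ∃ u ∈ L A, α = shift v u ∧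
      ∃ c : Fin n → ℚ, (∀ j, 0 ≤ c j) ∧ (fun i => (u i : ℚ)) = ∑ j, c j • b j

/-- `x^v (log x)^e` is a starting monomial: for some `A`-hypergeometric series
`x^v ∑_{u ∈ L} g_u(log x) x^u` in the direction of `w` with `g_0 ≠ 0`, the monomial `y^e` is the
initial monomial of `g_0` for the lexicographic order. -/
def IsStartingMonomial {k : Type*} [Field k] {d n : ℕ} (A : Matrix (Fin d) (Fin n) ℤ)
    (β : Fin d → k) (w : Fin n → ℝ) (v : Fin n → k) (e : Fin n →₀ ℕ) : Prop :=
  ∃ f : LogSeries k n, IsHypergeometric A β f ∧ InDirection A w v f ∧ f v ≠ 0 ∧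
    e = MonomialOrder.lex.degree (f v)

/-- `f = x^v ∑_{u ∈ L} g_u(log x) x^u` is a canonical `A`-hypergeometric series: it is a solution
in the direction of `w` with `g_0 ≠ 0`, and the only starting monomial that appears in it is
`x^v in(g_0)(log x)`. -/
def IsCanonical {k : Type*} [Field k] {d n : ℕ} (A : Matrix (Fin d) (Fin n) ℤ)
    (β : Fin d → k) (w : Fin n → ℝ) (v : Fin n → k) (f : LogSeries k n) : Prop :=
  IsHypergeometric A β f ∧ InDirection A w v f ∧ f v ≠ 0 ∧
    ∀ v' e, IsStartingMonomial A β w v' e → (f v').coeff e ≠ 0 →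
      v' = v ∧ e = MonomialOrder.lex.degree (f v)

/-- `f` is logarithm-free: all the `g_α` are constants. -/
def IsLogFree {k : Type*} [Field k] {n : ℕ} (f : LogSeries k n) : Prop :=
  ∀ α, ∃ c : k, f α = MvPolynomial.C c

/-! ### The series `φ_v` -/

/-- The negative support `nsupp(v) = {j : v_j ∈ ℤ_{<0}}`. -/
def nsupp {k : Type*} [Field k] {n : ℕ} (v : Fin n → k) : Set (Fin n) :=
  {j | ∃ m : ℤ, m < 0 ∧ v j = (m : k)}

/-- `{j : v_j ∉ ℤ}`. -/
def nonIntegral {k : Type*} [Field k] {n : ℕ} (v : Fin n → k) : Set (Fin n) :=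
  {j | ¬ ∃ m : ℤ, v j = (m : k)}

/-- `v` has minimal negative support: `nsupp(v)` is minimal among the `nsupp(v + u)`, `u ∈ L`. -/
def HasMinimalNegativeSupport {k : Type*} [Field k] {d n : ℕ} (A : Matrix (Fin d) (Fin n) ℤ)
    (v : Fin n → k) : Prop :=
  ∀ u ∈ L A, nsupp (shift v u) ⊆ nsupp v → nsupp (shift v u) = nsupp v

/-- `N_v = {u ∈ L : nsupp(v + u) = nsupp(v)}`. -/
def N {k : Type*} [Field k] {d n : ℕ} (A : Matrix (Fin d) (Fin n) ℤ) (v : Fin n → k) :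
    Set (Fin n → ℤ) :=
  {u | u ∈ L A ∧ nsupp (shift v u) = nsupp v}

/-- `[v]_t = ∏_j v_j (v_j - 1) ⋯ (v_j - t_j + 1)`. -/
def fallingProd {k : Type*} [Field k] {n : ℕ} (v : Fin n → k) (t : Fin n → ℕ) : k :=
  ∏ j, ∏ m ∈ Finset.range (t j), (v j - (m : k))

/-- `φ_v = x^v ∑_{u ∈ N_v} ([v]_{u₋} / [v + u]_{u₊}) x^u`, where `u = u₊ - u₋` with `u₊`, `u₋` in
`ℕ^n` of disjoint supports. -/
def phi {k : Type*} [Field k] {d n : ℕ} (A : Matrix (Fin d) (Fin n) ℤ) (v : Fin n → k) :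
    LogSeries k n :=
  Function.extend (fun u : N A v => shift v u.1)
    (fun u => MvPolynomial.C
      (fallingProd v (fun j => (-(u.1 j)).toNat) /
        fallingProd (shift v u.1) (fun j => (u.1 j).toNat)))
    0

end AHypergeometric

end

noncomputable section

namespace AHypergeometric

variable {k : Type*} [Field k] {d n : ℕ}

/-! ### The action of differential operators on formal series -/

/-! Write F for the set of columns in τ. An exponent v with A v = β whose coordinates off I are
natural numbers is governed by its vertex part ∑_{i ∈ I} v_i a_i. Modulo ℤI this part does not
change when v moves by an integer vector (`vertexSum_shift_sub_mem`), so it separates L-orbits. Each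
pair of a class in E_τ(β) and a coset of ℤI in ℤF prescribes one value modulo ℤI. Every value is
attained, because ℤF/ℤI is finite and so each coset of ℤI in ℤF meets ℕA (`exists_applyA_eq`). This
yields the required number of orbits, and series supported on distinct orbits are independent.

In each orbit a good representative must be found. First make the negative support minimal; then φ_v
is a solution (`isHypergeometric_phi`). Next minimize w on N_v. A minimum exists because the linear
form c that makes I a face lets w be replaced on L by a weight that is 0 on I and positive off I,
where the exponents are natural numbers, so Dickson's lemma applies (`isPWO_intWeight_image`).
Genericity makes the minimum strict (`intWeight_pos_of_mem_N`).

Strict positivity yields the rest. The support is generated by finitely many relations of positive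
weight, hence lies in a simplicial cone of positive weight (`exists_finset_N_subset_closure`,
`exists_basis_of_intWeight_pos`). Another exponent v + u of φ_v cannot start a solution with a
constant: ∂^{u₊} would have to kill x^(v+u), so some coordinate would leave the negative support
between v and v + u (`isCanonical_phi`).

Finiteness of E_τ(β) is Dickson's lemma again, through an antichain of exponent vectors
(`finite_E`). -/

theorem act_x (i : Fin n) : Weyl.act k n (Weyl.x k i) = mulX k i := by
  simp [Weyl.act, Weyl.x, genAction]

theorem act_del (i : Fin n) : Weyl.act k n (Weyl.del k i) = diffX k i := by
  simp [Weyl.act, Weyl.del, genAction]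

theorem diffX_apply_of_eq_C {f : LogSeries k n} {i : Fin n} {α : Fin n → k} {c : k}
    (h : f (α + Pi.single i 1) = MvPolynomial.C c) :
    diffX k i f α = MvPolynomial.C ((α i + 1) * c) := by
  simp [diffX, h, MvPolynomial.smul_eq_C_mul]

theorem diffX_pow_apply_of_eq_C {i : Fin n} {α : Fin n → k} (t : ℕ) {f : LogSeries k n} {c : k}
    (h : f (α + Pi.single i (t : k)) = MvPolynomial.C c) :
    (diffX k i ^ t) f α =
      MvPolynomial.C ((∏ s ∈ Finset.range t, (α i + (t : k) - (s : k))) * c) := by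
  induction t generalizing f c with
  | zero => simpa using h
  | succ t ih =>
    rw [pow_succ, Module.End.mul_apply]
    have h1 : diffX k i f (α + Pi.single i (t : k)) =
        MvPolynomial.C ((α i + t + 1) * c) := by
      have := diffX_apply_of_eq_C (f := f) (i := i) (α := α + Pi.single i (t : k)) (c := c)
        (by rw [add_assoc, ← Pi.single_add]; exact_mod_cast h)
      simpa using this
    rw [ih h1, Finset.prod_range_succ']
    congr 1
    have : ∀ s : ℕ, α i + ((t + 1 : ℕ) : k) - ((s + 1 : ℕ) : k) = α i + (t : k) - s := by
      intro s; push_cast; ring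
    simp only [this]
    push_cast
    ring

theorem listProd_diffX_apply (m : Fin n → ℕ) (l : List (Fin n)) (hl : l.Nodup)
    {f : LogSeries k n} {α : Fin n → k} {c : k}
    (h : f (α + (l.map fun i => Pi.single i (m i : k)).sum) = MvPolynomial.C c) :
    (l.map fun i => diffX k i ^ m i).prod f α =
      MvPolynomial.C ((l.map fun i =>
        ∏ s ∈ Finset.range (m i), (α i + (m i : k) - (s : k))).prod * c) := by
  induction l generalizing α with
  | nil => simpa using h
  | cons i l ih =>
    rw [List.nodup_cons] at hl
    simp only [List.map_cons, List.prod_cons, List.sum_cons, Module.End.mul_apply] at h ⊢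
    have h1 := ih hl.2 (α := α + Pi.single i (m i : k)) (by rw [add_assoc]; exact h)
    have h2 : (l.map fun j => ∏ s ∈ Finset.range (m j),
          ((α + Pi.single i (m i : k) : Fin n → k) j + (m j : k) - (s : k))) =
        l.map fun j => ∏ s ∈ Finset.range (m j), (α j + (m j : k) - (s : k)) := by
      refine List.map_congr_left fun j hj => ?_
      have : j ≠ i := fun e => hl.1 (e ▸ hj)
      simp [this]
    rw [h2] at h1
    rw [diffX_pow_apply_of_eq_C _ h1, mul_assoc]

/-- Locality: ∂^m f at α depends on f only at α + m. Constancy is needed at that single exponent, so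
this also applies to solutions with logarithms elsewhere. -/
theorem act_delPow_apply {f : LogSeries k n} {α : Fin n → k} {m : Fin n →₀ ℕ} {c : k}
    (h : f (fun j => α j + (m j : k)) = MvPolynomial.C c) :
    Weyl.act k n (Weyl.delPow k m) f α =
      MvPolynomial.C (fallingProd (fun j => α j + (m j : k)) m * c) := by
  have h1 := listProd_diffX_apply (k := k) m (List.finRange n) (List.nodup_finRange n)
    (f := f) (α := α) (c := c) (by
      rw [← Fin.sum_univ_def, Finset.univ_sum_single]; exact h)
  rw [← Fin.prod_univ_def] at h1
  simp only [Weyl.delPow, map_list_prod, List.map_map]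
  have h2 : (⇑(Weyl.act k n) ∘ fun i => Weyl.del k i ^ m i) = fun i => diffX k i ^ m i := by
    funext i
    simp [act_del]
  rw [h2, h1]
  rfl

theorem isHypergeometric_of_generators {A : Matrix (Fin d) (Fin n) ℤ} {β : Fin d → k}
    {f : LogSeries k n}
    (h1 : ∀ p ∈ toricIdeal k A, Weyl.act k n (Weyl.ofPoly p) f = 0)
    (h2 : ∀ i, ∑ j, (A i j : k) • mulX k j (diffX k j f) = β i • f) :
    IsHypergeometric A β f := by
  intro P hP
  induction hP using Submodule.span_induction with
  | mem x hx =>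
    rcases hx with ⟨p, hp, rfl⟩ | ⟨i, rfl⟩
    · exact h1 p hp
    · have := h2 i
      simp only [map_sub, map_sum, map_smul, map_mul, act_x, act_del, AlgHom.commutes,
        LinearMap.sub_apply, LinearMap.sum_apply, LinearMap.smul_apply, Module.End.mul_apply,
        Module.algebraMap_end_apply, this, sub_self]
  | zero => simp
  | add x y _ _ hx hy => simp [hx, hy]
  | smul a x _ hx => simp [hx]

/-! ### Toric ideals -/

/-- The linear functional with value `g m` on the monomial `m`. -/
def monomialFunctional {M : Type*} [AddCommGroup M] [Module k M] (g : (Fin n →₀ ℕ) → M) :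
    MvPolynomial (Fin n) k →ₗ[k] M :=
  (MvPolynomial.basisMonomials (Fin n) k).constr k g

theorem monomialFunctional_apply {M : Type*} [AddCommGroup M] [Module k M]
    (g : (Fin n →₀ ℕ) → M) (p : MvPolynomial (Fin n) k) :
    monomialFunctional g p = ∑ m ∈ p.support, p.coeff m • g m := by
  rw [monomialFunctional, Module.Basis.constr_apply]
  rfl

theorem monomialFunctional_monomial {M : Type*} [AddCommGroup M] [Module k M]
    (g : (Fin n →₀ ℕ) → M) (m : Fin n →₀ ℕ) (c : k) :
    monomialFunctional g (MvPolynomial.monomial m c) = c • g m := by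
  have : MvPolynomial.monomial m c = c • MvPolynomial.basisMonomials (Fin n) k m := by
    simp [MvPolynomial.smul_monomial]
  rw [this, map_smul, monomialFunctional, Module.Basis.constr_basis]

theorem monomialFunctional_monomial_mul {M : Type*} [AddCommGroup M] [Module k M]
    (g : (Fin n →₀ ℕ) → M) (r : Fin n →₀ ℕ) (c : k) (p : MvPolynomial (Fin n) k) :
    monomialFunctional g (MvPolynomial.monomial r c * p) =
      c • monomialFunctional (fun m => g (r + m)) p := by
  induction p using MvPolynomial.induction_on' with
  | monomial u a =>
    rw [MvPolynomial.monomial_mul, monomialFunctional_monomial, monomialFunctional_monomial,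
      mul_smul]
  | add p q hp hq => rw [mul_add, map_add, hp, hq, map_add, smul_add]

/-- A family of functionals that is stable under multiplication by monomials and vanishes on the
generators of an ideal vanishes on the ideal. -/
theorem monomialFunctional_eq_zero_of_mem_span {M : Type*} [AddCommGroup M] [Module k M]
    {S : Set (MvPolynomial (Fin n) k)} {g : (Fin n →₀ ℕ) → M}
    (h : ∀ r : Fin n →₀ ℕ, ∀ p ∈ S, monomialFunctional (fun m => g (r + m)) p = 0)
    {p : MvPolynomial (Fin n) k} (hp : p ∈ Ideal.span S) : monomialFunctional g p = 0 := by
  have key : ∀ r : Fin n →₀ ℕ, monomialFunctional (fun m => g (r + m)) p = 0 := by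
    induction hp using Submodule.span_induction with
    | mem x hx => exact fun r => h r x hx
    | zero => simp
    | add x y _ _ hx hy => intro r; rw [map_add, hx, hy, add_zero]
    | smul a x _ hx =>
      intro r
      rw [smul_eq_mul]
      induction a using MvPolynomial.induction_on' with
      | monomial u c =>
        rw [monomialFunctional_monomial_mul]
        simp only [← add_assoc, hx, smul_zero]
      | add p q hp hq => rw [add_mul, map_add, hp, hq, add_zero]
  simpa using key 0

/-- Fibres of A are stable under adding a fixed exponent, so functionals constant on fibres form a
family as in `monomialFunctional_eq_zero_of_mem_span`. Values in a module allow both indicators of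
fibres and g m = ∂^m φ_v. -/
theorem toricIdeal_sum_eq_zero {A : Matrix (Fin d) (Fin n) ℤ} {M : Type*} [AddCommGroup M]
    [Module k M] (g : (Fin n →₀ ℕ) → M)
    (hg : ∀ u v : Fin n →₀ ℕ,
      (∀ i, ∑ j, A i j * (u j : ℤ) = ∑ j, A i j * (v j : ℤ)) → g u = g v)
    {p : MvPolynomial (Fin n) k} (hp : p ∈ toricIdeal k A) :
    ∑ m ∈ p.support, p.coeff m • g m = 0 := by
  rw [← monomialFunctional_apply]
  refine monomialFunctional_eq_zero_of_mem_span ?_ hp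
  rintro r _ ⟨u, v, huv, rfl⟩
  rw [map_sub, monomialFunctional_monomial, monomialFunctional_monomial, hg (r + u) (r + v),
    sub_self]
  intro i
  have := huv i
  simp only [Finsupp.add_apply, Nat.cast_add, mul_add, Finset.sum_add_distrib, this]

/-! ### Initial ideals and monomials of minimal weight -/

theorem weight_add (w : Fin n → ℝ) (a b : Fin n →₀ ℕ) :
    weight w (a + b) = weight w a + weight w b := by
  simp [weight, mul_add, Finset.sum_add_distrib]

/-- A monomial of minimal weight in its fibre does not lie in the initial ideal. -/
theorem monomial_notMem_initialIdeal {A : Matrix (Fin d) (Fin n) ℤ} {w : Fin n → ℝ}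
    {m₀ : Fin n →₀ ℕ}
    (hm : ∀ m : Fin n →₀ ℕ, (∀ i, ∑ j, A i j * (m j : ℤ) = ∑ j, A i j * (m₀ j : ℤ)) →
      weight w m₀ ≤ weight w m) :
    MvPolynomial.monomial m₀ (1 : k) ∉ initialIdeal w (toricIdeal k A) := by
  classical
  intro hmem
  set P : (Fin n →₀ ℕ) → Prop := fun m => ∀ i, ∑ j, A i j * (m j : ℤ) = ∑ j, A i j * (m₀ j : ℤ)
    with hP
  -- `g` tests the fibre of `m₀` at exactly the weight of `m₀`; it equals 1 at `m₀` and is shown to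
  -- vanish on the initial ideal.
  set g : (Fin n →₀ ℕ) → k := fun m => if P m ∧ weight w m = weight w m₀ then 1 else 0 with hg
  have h0 : monomialFunctional g (MvPolynomial.monomial m₀ (1 : k)) = 0 := by
    refine monomialFunctional_eq_zero_of_mem_span ?_ hmem
    rintro r _ ⟨f, hf, rfl⟩
    simp only [initialForm, map_sum, monomialFunctional_monomial]
    by_cases hex : ∃ m ∈ f.support, (∀ m' ∈ f.support, weight w m' ≤ weight w m) ∧
        weight w (r + m) = weight w m₀
    -- The leading weight of x^r f is now that of `m₀`, the least in its fibre. Terms of f landing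
    -- in the fibre are thus all leading, and the sum over the initial form equals the sum over f.
    · obtain ⟨m₁, hm₁, hmax, hw₁⟩ := hex
      have h1 := toricIdeal_sum_eq_zero (k := k) (A := A)
        (fun m => if P (r + m) then (1 : k) else 0) (by
          intro u v huv
          have : P (r + u) ↔ P (r + v) := by
            simp only [hP, Finsupp.add_apply, Nat.cast_add, mul_add, Finset.sum_add_distrib, huv]
          simp only [this]) hf
      rw [← h1, Finset.sum_filter]
      refine Finset.sum_congr rfl fun m hms => ?_
      have hle := hmax m hms
      rw [weight_add] at hw₁
      by_cases hPm : P (r + m)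
      · have hge := hm _ hPm
        rw [weight_add] at hge
        have : weight w m = weight w m₁ := by linarith
        have h2 : ∀ m' ∈ f.support, weight w m' ≤ weight w m := by rw [this]; exact hmax
        rw [if_pos h2]
        simp only [hg, hPm, weight_add, true_and, if_true]
        rw [if_pos (by linarith)]
      · simp [hg, hPm]
    · refine Finset.sum_eq_zero fun m hms => ?_
      rw [Finset.mem_filter] at hms
      have : ¬ (weight w (r + m) = weight w m₀) := fun h => hex ⟨m, hms.1, hms.2, h⟩
      simp [hg, this]
  rw [monomialFunctional_monomial] at h0
  simp [hg, hP] at h0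

/-! ### The lattice of relations -/

theorem mem_L {A : Matrix (Fin d) (Fin n) ℤ} {u : Fin n → ℤ} :
    u ∈ L A ↔ ∀ i, ∑ j, A i j * u j = 0 := by
  simp only [L, Submodule.mem_toAddSubgroup, LinearMap.mem_ker, Matrix.toLin'_apply]
  rw [funext_iff]
  rfl

/-- The weight `w · u` of an integer vector. -/
def intWeight (w : Fin n → ℝ) (u : Fin n → ℤ) : ℝ := ∑ j, w j * (u j : ℝ)

theorem intWeight_add (w : Fin n → ℝ) (a b : Fin n → ℤ) :
    intWeight w (a + b) = intWeight w a + intWeight w b := by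
  simp [intWeight, mul_add, Finset.sum_add_distrib]

theorem intWeight_neg (w : Fin n → ℝ) (a : Fin n → ℤ) :
    intWeight w (-a) = -intWeight w a := by
  simp [intWeight]

/-- The positive part `u₊` as an exponent vector. -/
def posPart (u : Fin n → ℤ) : Fin n →₀ ℕ := Finsupp.equivFunOnFinite.symm fun j => (u j).toNat

@[simp] theorem posPart_apply (u : Fin n → ℤ) (j : Fin n) : posPart u j = (u j).toNat := rfl

theorem posPart_sub_posPart_neg (u : Fin n → ℤ) (j : Fin n) :
    (posPart u j : ℤ) - (posPart (-u) j : ℤ) = u j := by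
  simp only [posPart_apply, Pi.neg_apply]
  omega

theorem weight_posPart_sub (w : Fin n → ℝ) (u : Fin n → ℤ) :
    weight w (posPart u) - weight w (posPart (-u)) = intWeight w u := by
  simp only [weight, intWeight, ← Finset.sum_sub_distrib, ← mul_sub]
  refine Finset.sum_congr rfl fun j _ => ?_
  rw [← posPart_sub_posPart_neg u j]
  push_cast
  rfl

theorem posPart_fibre {A : Matrix (Fin d) (Fin n) ℤ} {u : Fin n → ℤ} (hu : u ∈ L A) (i : Fin d) :
    ∑ j, A i j * (posPart u j : ℤ) = ∑ j, A i j * (posPart (-u) j : ℤ) := by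
  rw [← sub_eq_zero, ← Finset.sum_sub_distrib, ← mem_L.1 hu i]
  refine Finset.sum_congr rfl fun j _ => ?_
  rw [← mul_sub, posPart_sub_posPart_neg]

theorem binomial_mem_toricIdeal {A : Matrix (Fin d) (Fin n) ℤ} {u : Fin n → ℤ} (hu : u ∈ L A) :
    MvPolynomial.monomial (posPart u) (1 : k) - MvPolynomial.monomial (posPart (-u)) 1 ∈
      toricIdeal k A :=
  Ideal.subset_span ⟨_, _, posPart_fibre hu, rfl⟩

theorem posPart_ne {u : Fin n → ℤ} (hu : u ≠ 0) : posPart u ≠ posPart (-u) := by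
  intro h
  refine hu (funext fun j => ?_)
  rw [← posPart_sub_posPart_neg u j, h, sub_self, Pi.zero_apply]

open Classical in
theorem support_binomial {a b : Fin n →₀ ℕ} (h : a ≠ b) :
    (MvPolynomial.monomial a (1 : k) - MvPolynomial.monomial b 1).support = {a, b} := by
  ext m
  simp only [MvPolynomial.mem_support_iff, MvPolynomial.coeff_sub, MvPolynomial.coeff_monomial,
    Finset.mem_insert, Finset.mem_singleton]
  by_cases h1 : a = m <;> by_cases h2 : b = m
  · exact absurd (h1.trans h2.symm) h
  · simp [h1, h2]
  · simp [h1, h2]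
  · simp [h1, h2, Ne.symm h1, Ne.symm h2]

/-- For generic weights, the positive part of a nonzero relation of weight zero is not of minimal
weight in its fibre. -/
theorem IsGeneric.exists_weight_lt {A : Matrix (Fin d) (Fin n) ℤ} {w : Fin n → ℝ}
    (hw : IsGeneric k A w) {p : Fin n → ℤ} (hp : p ∈ L A) (hp0 : p ≠ 0)
    (hwp : intWeight w p = 0) :
    ∃ m : Fin n →₀ ℕ, (∀ i, ∑ j, A i j * (m j : ℤ) = ∑ j, A i j * (posPart p j : ℤ)) ∧
      weight w m < weight w (posPart p) := by
  classical
  by_contra! hcon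
  obtain ⟨-, S, hS⟩ := hw
  refine monomial_notMem_initialIdeal (k := k) hcon ?_
  have hne := posPart_ne hp0
  have hweq : weight w (posPart p) = weight w (posPart (-p)) := by
    have := weight_posPart_sub w p
    linarith
  set f : MvPolynomial (Fin n) k :=
    MvPolynomial.monomial (posPart p) (1 : k) - MvPolynomial.monomial (posPart (-p)) 1 with hf
  have hsupp : f.support = {posPart p, posPart (-p)} := support_binomial hne
  have hin : initialForm w f = f := by
    rw [initialForm, Finset.filter_true_of_mem, ← MvPolynomial.as_sum]
    intro m hm m' hm'
    rw [hsupp] at hm hm'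
    simp only [Finset.mem_insert, Finset.mem_singleton] at hm hm'
    rcases hm with rfl | rfl <;> rcases hm' with rfl | rfl <;> simp [hweq]
  have hmem : f ∈ initialIdeal w (toricIdeal k A) := by
    rw [← hin]
    exact Ideal.subset_span ⟨f, binomial_mem_toricIdeal hp, rfl⟩
  -- The binomial is its own initial form; a monomial ideal containing it contains each of its
  -- terms.
  rw [hS, MvPolynomial.mem_ideal_span_monomial_image] at hmem
  obtain ⟨s, hs, hle⟩ := hmem (posPart p) (by rw [hsupp]; simp)
  rw [hS, MvPolynomial.mem_ideal_span_monomial_image]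
  intro m hm
  rw [MvPolynomial.support_monomial, if_neg one_ne_zero, Finset.mem_singleton] at hm
  exact ⟨s, hs, hm ▸ hle⟩

/-! ### Shifts and negative supports -/

theorem shift_zero (v : Fin n → k) : shift v 0 = v := by
  funext j; simp [shift]

theorem shift_shift (v : Fin n → k) (a b : Fin n → ℤ) : shift (shift v a) b = shift v (a + b) := by
  funext j; simp [shift, add_assoc]

theorem shift_injective [CharZero k] (v : Fin n → k) : Function.Injective (shift v) := by
  intro a b h
  funext j
  have := congrFun h j
  simpa [shift] using this

theorem applyA_apply (A : Matrix (Fin d) (Fin n) ℤ) (v : Fin n → k) (i : Fin d) :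
    applyA A v i = ∑ j, v j * (A i j : k) := by
  simp [applyA, col]

theorem applyA_shift {A : Matrix (Fin d) (Fin n) ℤ} {u : Fin n → ℤ} (hu : u ∈ L A)
    (v : Fin n → k) : applyA A (shift v u) = applyA A v := by
  funext i
  have := congrArg (Int.cast : ℤ → k) (mem_L.1 hu i)
  push_cast at this
  simp only [applyA_apply, shift, add_mul, Finset.sum_add_distrib]
  simp only [mul_comm _ ((A i _ : ℤ) : k)]
  rw [this, add_zero]

theorem mem_nsupp_shift [CharZero k] {v : Fin n → k} {u : Fin n → ℤ} {j : Fin n} {m : ℤ}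
    (hm : v j = m) : j ∈ nsupp (shift v u) ↔ m + u j < 0 := by
  simp only [nsupp, Set.mem_ofPred_eq, shift, hm]
  constructor
  · rintro ⟨m', h0, h⟩
    have : m + u j = m' := by exact_mod_cast h
    omega
  · intro h
    exact ⟨_, h, by push_cast; rfl⟩

theorem mem_nsupp_iff [CharZero k] {v : Fin n → k} {j : Fin n} {m : ℤ}
    (hm : v j = m) : j ∈ nsupp v ↔ m < 0 := by
  have := mem_nsupp_shift (u := 0) hm
  simpa [shift_zero] using this

theorem notMem_nsupp_shift {v : Fin n → k} {j : Fin n} (hj : j ∈ nonIntegral v)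
    (u : Fin n → ℤ) : j ∉ nsupp (shift v u) := by
  rintro ⟨m, -, h⟩
  refine hj ⟨m - u j, ?_⟩
  simp only [shift] at h
  push_cast
  rw [← h]
  ring

theorem nonIntegral_shift (v : Fin n → k) (u : Fin n → ℤ) :
    nonIntegral (shift v u) = nonIntegral v := by
  ext j
  simp only [nonIntegral, Set.mem_ofPred_eq, not_iff_not, shift]
  constructor
  · rintro ⟨m, h⟩
    exact ⟨m - u j, by push_cast; rw [← h]; ring⟩
  · rintro ⟨m, h⟩
    exact ⟨m + u j, by push_cast; rw [← h]⟩

theorem nsupp_shift_subset_iff [CharZero k] {v : Fin n → k} {a b : Fin n → ℤ} :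
    nsupp (shift v a) ⊆ nsupp (shift v b) ↔
      ∀ j, ∀ m : ℤ, v j = m → m + a j < 0 → m + b j < 0 := by
  constructor
  · intro h j m hm hneg
    exact (mem_nsupp_shift hm).1 (h ((mem_nsupp_shift hm).2 hneg))
  · intro h j hj
    by_cases hjn : j ∈ nonIntegral v
    · exact absurd hj (notMem_nsupp_shift hjn a)
    · obtain ⟨m, hm⟩ := not_not.1 hjn
      exact (mem_nsupp_shift hm).2 (h j m hm ((mem_nsupp_shift hm).1 hj))

theorem fallingProd_eq_zero_iff {y : Fin n → k} {t : Fin n → ℕ} :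
    fallingProd y t = 0 ↔ ∃ j, ∃ m < t j, y j = (m : k) := by
  simp [fallingProd, Finset.prod_eq_zero_iff, sub_eq_zero]

/-- A factor of [v + z + m]_m vanishes exactly when an integral coordinate crosses from nonnegative
to negative on descending from v + z + m to v + z. -/
theorem fallingProd_ne_zero_of_nsupp [CharZero k] {v : Fin n → k} {z : Fin n → ℤ} {m : Fin n → ℕ}
    (h : nsupp (shift v (fun j => z j + m j)) = nsupp (shift v z)) :
    fallingProd (shift v (fun j => z j + m j)) m ≠ 0 := by
  rw [Ne, fallingProd_eq_zero_iff]
  rintro ⟨j, t, ht, hj⟩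
  have hv : v j = ((t - z j - m j : ℤ) : k) := by
    simp only [shift] at hj
    push_cast at hj ⊢
    rw [← hj]; ring
  have := nsupp_shift_subset_iff.1 h.ge j _ hv (by omega)
  omega

theorem fallingProd_eq_zero_of_nsupp [CharZero k] {v : Fin n → k} {z : Fin n → ℤ} {m : Fin n → ℕ}
    (h : nsupp (shift v (fun j => z j + m j)) ≠ nsupp (shift v z)) :
    fallingProd (shift v (fun j => z j + m j)) m = 0 := by
  by_contra h0
  refine h (Set.Subset.antisymm ?_ ?_)
  · rw [nsupp_shift_subset_iff]
    intro j a _ ha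
    omega
  · rw [nsupp_shift_subset_iff]
    intro j a hva ha
    by_contra hge
    refine h0 (fallingProd_eq_zero_iff.2 ⟨j, (a + (z j + m j)).toNat, by omega, ?_⟩)
    have : (((a + (z j + m j)).toNat : ℤ) : k) = ((a + (z j + m j) : ℤ) : k) := by
      rw [Int.toNat_of_nonneg (by omega)]
    rw [← Int.cast_natCast, this, shift, hva]
    push_cast
    rfl

/-! ### The coefficients of `φ_v` -/

/-- The ratio `[x]_{s₋} / [x + s]_{s₊}` in one variable. -/
def ratio (x : k) (s : ℤ) : k :=
  (∏ m ∈ Finset.range (-s).toNat, (x - (m : k))) /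
    ∏ m ∈ Finset.range s.toNat, (x + (s : k) - (m : k))

/-- Lowering s by one adds a numerator factor if s ≤ 0 and cancels the top denominator factor if s >
0. -/
theorem mul_ratio {x : k} {s : ℤ} (h : x + (s : k) ≠ 0) :
    (x + (s : k)) * ratio x s = ratio x (s - 1) := by
  rcases le_or_gt s 0 with hs | hs
  · obtain ⟨t, rfl⟩ : ∃ t : ℕ, s = -(t : ℤ) := ⟨s.natAbs, by omega⟩
    have h1 : (-(-(t : ℤ))).toNat = t := by omega
    have h2 : (-(t : ℤ)).toNat = 0 := by omega
    have h3 : (-(-(t : ℤ) - 1)).toNat = t + 1 := by omega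
    have h4 : (-(t : ℤ) - 1).toNat = 0 := by omega
    simp only [ratio, h1, h2, h3, h4, Finset.range_zero, Finset.prod_empty, div_one,
      Finset.prod_range_succ]
    push_cast
    ring
  · obtain ⟨t, rfl⟩ : ∃ t : ℕ, s = (t : ℤ) + 1 := ⟨(s - 1).toNat, by omega⟩
    have h1 : (-((t : ℤ) + 1)).toNat = 0 := by omega
    have h2 : ((t : ℤ) + 1).toNat = t + 1 := by omega
    have h3 : (-((t : ℤ) + 1 - 1)).toNat = 0 := by omega
    have h4 : ((t : ℤ) + 1 - 1).toNat = t := by omega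
    simp only [ratio, h1, h2, h3, h4, Finset.range_zero, Finset.prod_empty,
      Finset.prod_range_succ']
    have h5 : ∀ m : ℕ, x + (((t : ℤ) + 1 : ℤ) : k) - ((m + 1 : ℕ) : k) =
        x + (((t : ℤ) + 1 - 1 : ℤ) : k) - m := by
      intro m; push_cast; ring
    simp only [h5, Nat.cast_zero, sub_zero]
    rw [mul_one_div, div_mul_cancel_right₀ h, one_div]

theorem prod_mul_ratio {x : k} {s : ℤ} (m : ℕ)
    (h : ∏ t ∈ Finset.range m, (x + (s : k) - (t : k)) ≠ 0) :
    (∏ t ∈ Finset.range m, (x + (s : k) - (t : k))) * ratio x s = ratio x (s - m) := by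
  induction m with
  | zero => simp
  | succ m ih =>
    rw [Finset.prod_range_succ] at h ⊢
    rw [mul_right_comm, ih (left_ne_zero_of_mul h), mul_comm]
    have h1 := right_ne_zero_of_mul h
    have h2 : x + (s : k) - (m : k) = x + ((s - m : ℤ) : k) := by push_cast; ring
    rw [h2] at h1 ⊢
    rw [mul_ratio h1]
    push_cast
    rw [sub_sub]

open Classical in
/-- The coefficient of `x^(v + u)` in `φ_v`, extended to all `u ∈ ℤ^n`. -/
def phiCoeff (v : Fin n → k) (u : Fin n → ℤ) : k :=
  if nsupp (shift v u) = nsupp v then ∏ j, ratio (v j) (u j) else 0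

theorem phiCoeff_zero (v : Fin n → k) : phiCoeff v 0 = 1 := by
  simp [phiCoeff, shift_zero, ratio]

theorem phi_shift [CharZero k] {A : Matrix (Fin d) (Fin n) ℤ} (v : Fin n → k) {u : Fin n → ℤ}
    (hu : u ∈ L A) : phi A v (shift v u) = MvPolynomial.C (phiCoeff v u) := by
  by_cases h : nsupp (shift v u) = nsupp v
  · have hinj : Function.Injective (fun u : N A v => shift v u.1) :=
      (shift_injective v).comp Subtype.val_injective
    have := hinj.extend_apply (fun u : N A v => MvPolynomial.C (σ := Fin n)
      (fallingProd v (fun j => (-(u.1 j)).toNat) /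
        fallingProd (shift v u.1) (fun j => (u.1 j).toNat))) 0 ⟨u, hu, h⟩
    rw [phi]
    refine this.trans ?_
    rw [phiCoeff, if_pos h, fallingProd, fallingProd, ← Finset.prod_div_distrib]
    rfl
  · rw [phiCoeff, if_neg h, phi, Function.extend_apply', Pi.zero_apply, map_zero]
    rintro ⟨a, ha⟩
    rw [← shift_injective v ha] at h
    exact h a.2.2

theorem exists_of_phi_ne_zero {A : Matrix (Fin d) (Fin n) ℤ} {v α : Fin n → k}
    (h : phi A v α ≠ 0) : ∃ u ∈ N A v, α = shift v u := by
  by_contra hcon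
  refine h ?_
  rw [phi, Function.extend_apply', Pi.zero_apply]
  rintro ⟨a, ha⟩
  exact hcon ⟨a.1, a.2, ha.symm⟩

theorem phi_eq_zero {A : Matrix (Fin d) (Fin n) ℤ} {v α : Fin n → k}
    (h : ∀ u ∈ L A, α ≠ shift v u) : phi A v α = 0 := by
  by_contra h0
  obtain ⟨u, hu, e⟩ := exists_of_phi_ne_zero h0
  exact h u hu.1 e

theorem isLogFree_phi [CharZero k] (A : Matrix (Fin d) (Fin n) ℤ) (v : Fin n → k) :
    IsLogFree (phi A v) := by
  intro α
  by_cases h : phi A v α = 0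
  · exact ⟨0, by rw [h, map_zero]⟩
  · obtain ⟨u, hu, rfl⟩ := exists_of_phi_ne_zero h
    exact ⟨_, phi_shift v hu.1⟩

theorem phi_self [CharZero k] (A : Matrix (Fin d) (Fin n) ℤ) (v : Fin n → k) :
    phi A v v = 1 := by
  have := phi_shift (A := A) v (zero_mem _)
  rwa [shift_zero, phiCoeff_zero, map_one] at this

/-- The right side does not involve m; this makes all ∂^m in one fibre act alike on φ_v. If the
negative support changes along m the falling product is 0, and minimality excludes that v + z still
has the negative support of v. -/
theorem fallingProd_mul_phiCoeff [CharZero k] {A : Matrix (Fin d) (Fin n) ℤ} {v : Fin n → k}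
    (hv : HasMinimalNegativeSupport A v) {z : Fin n → ℤ} {m : Fin n → ℕ}
    (hz : (fun j => z j + m j) ∈ L A) :
    fallingProd (shift v (fun j => z j + m j)) m * phiCoeff v (fun j => z j + m j) =
      phiCoeff v z := by
  by_cases h1 : nsupp (shift v (fun j => z j + m j)) = nsupp (shift v z)
  · by_cases h2 : nsupp (shift v z) = nsupp v
    · rw [phiCoeff, phiCoeff, if_pos (h1.trans h2), if_pos h2, fallingProd,
        ← Finset.prod_mul_distrib]
      refine Finset.prod_congr rfl fun j _ => ?_
      have hne := fallingProd_ne_zero_of_nsupp h1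
      rw [fallingProd, Finset.prod_ne_zero_iff] at hne
      have := prod_mul_ratio (m j) (hne j (Finset.mem_univ j))
      simpa [shift] using this
    · rw [phiCoeff, phiCoeff, if_neg h2, if_neg (fun h => h2 (h1.symm.trans h)), mul_zero]
  · rw [fallingProd_eq_zero_of_nsupp h1, zero_mul, phiCoeff, if_neg]
    intro h2
    refine h1 ((hv _ hz ?_).trans h2.symm)
    rw [← h2, nsupp_shift_subset_iff]
    intro j a _ ha
    omega

theorem act_ofPoly (p : MvPolynomial (Fin n) k) (f : LogSeries k n) :
    Weyl.act k n (Weyl.ofPoly p) f =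
      ∑ m ∈ p.support, p.coeff m • Weyl.act k n (Weyl.delPow k m) f := by
  simp [Weyl.ofPoly, LinearMap.sum_apply]

/-- At x^(v+z), both terms of a toric binomial give `phiCoeff v z`. The Euler operators act
diagonally on log-free terms, and A(v + u) = β for u in L. -/
theorem isHypergeometric_phi [CharZero k] {A : Matrix (Fin d) (Fin n) ℤ} {β : Fin d → k}
    {v : Fin n → k} (hβ : applyA A v = β) (hv : HasMinimalNegativeSupport A v) :
    IsHypergeometric A β (phi A v) := by
  refine isHypergeometric_of_generators (fun p hp => ?_) fun i => ?_
  · rw [act_ofPoly]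
    refine toricIdeal_sum_eq_zero _ (fun a b hab => funext fun α => ?_) hp
    have hmem : ∀ z : Fin n → ℤ, (fun j => z j + (a j : ℤ)) ∈ L A ↔
        (fun j => z j + (b j : ℤ)) ∈ L A := by
      intro z
      simp only [mem_L, mul_add, Finset.sum_add_distrib, hab]
    have key : ∀ (c : Fin n →₀ ℕ) (z : Fin n → ℤ), (fun j => z j + (c j : ℤ)) ∈ L A →
        α = shift v z →
        Weyl.act k n (Weyl.delPow k c) (phi A v) α = MvPolynomial.C (phiCoeff v z) := by
      rintro c z hz rfl
      have e : (fun j => shift v z j + (c j : k)) = shift v (fun j => z j + (c j : ℤ)) := by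
        funext j; simp [shift, add_assoc]
      rw [act_delPow_apply (by rw [e]; exact phi_shift v hz), e,
        fallingProd_mul_phiCoeff hv hz]
    have key0 : ∀ c : Fin n →₀ ℕ,
        (∀ z : Fin n → ℤ, (fun j => z j + (c j : ℤ)) ∈ L A → α ≠ shift v z) →
        Weyl.act k n (Weyl.delPow k c) (phi A v) α = 0 := by
      intro c hc
      rw [act_delPow_apply (c := 0), mul_zero, map_zero]
      rw [map_zero]
      refine phi_eq_zero fun u hu e => hc (fun j => u j - c j) (by simpa using hu) ?_
      funext j
      have := congrFun e j
      simp only [shift] at this ⊢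
      push_cast
      rw [← add_sub_assoc, ← this]
      ring
    by_cases hex : ∃ z : Fin n → ℤ, (fun j => z j + (a j : ℤ)) ∈ L A ∧ α = shift v z
    · obtain ⟨z, hz, hα⟩ := hex
      rw [key a z hz hα, key b z ((hmem z).1 hz) hα]
    · push Not at hex
      rw [key0 a hex, key0 b fun z hz => hex z ((hmem z).2 hz)]
  · have hE : ∀ j, mulX k j (diffX k j (phi A v)) = fun α => α j • phi A v α := by
      intro j
      funext α
      have e : α - Pi.single j 1 + Pi.single j 1 = α := sub_add_cancel _ _
      obtain ⟨c, hc⟩ := isLogFree_phi A v α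
      have h1 : diffX k j (phi A v) (α - Pi.single j 1) = _ :=
        diffX_apply_of_eq_C (by rw [e]; exact hc)
      have h2 : mulX k j (diffX k j (phi A v)) α = diffX k j (phi A v) (α - Pi.single j 1) := rfl
      rw [h2, h1, hc, MvPolynomial.smul_eq_C_mul, ← map_mul]
      simp
    funext α
    simp only [hE, Finset.sum_apply, Pi.smul_apply, smul_smul, ← Finset.sum_smul]
    by_cases h0 : phi A v α = 0
    · simp [h0]
    · obtain ⟨u, hu, rfl⟩ := exists_of_phi_ne_zero h0
      rw [← hβ, ← applyA_shift hu.1 v, applyA_apply]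
      simp only [mul_comm]

/-! ### Simplicial cones of positive weight -/

/-- Finitely many integer vectors of positive weight lie in the cone over a rational basis of
positive weight. -/
theorem exists_basis_of_intWeight_pos {w : Fin n → ℝ} (hw : w ≠ 0) (T : Finset (Fin n → ℤ))
    (hT : ∀ q ∈ T, 0 < intWeight w q) :
    ∃ b : Module.Basis (Fin n) ℚ (Fin n → ℚ), (∀ j, 0 < ∑ i, w i * ((b j i : ℚ) : ℝ)) ∧
      ∀ q ∈ T, ∃ c : Fin n → ℚ, (∀ j, 0 ≤ c j) ∧ (fun i => (q i : ℚ)) = ∑ j, c j • b j := by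
  obtain ⟨j₀, hj₀⟩ : ∃ j, w j ≠ 0 := Function.ne_iff.1 hw
  have hn : 0 < (n : ℝ) := by exact_mod_cast Fin.pos j₀
  -- Rows e_j for j ≠ j₀ and -∑_{i ≠ j₀} e_i for j₀ sum to zero, so w stays the mean of the
  -- perturbed rows w + ε B_j.
  set B : Fin n → Fin n → ℝ := fun j i =>
    if j = j₀ then (if i = j₀ then 0 else -1) else (if i = j then 1 else 0) with hB
  have hBsum : ∀ i, ∑ j, B j i = 0 := by
    intro i
    rw [← Finset.add_sum_erase _ _ (Finset.mem_univ j₀)]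
    have h1 : ∑ j ∈ Finset.univ.erase j₀, B j i =
        ∑ j ∈ Finset.univ.erase j₀, if i = j then 1 else 0 :=
      Finset.sum_congr rfl fun j hj => by simp [hB, Finset.ne_of_mem_erase hj]
    rw [h1, Finset.sum_ite_eq]
    by_cases hi : i = j₀ <;> simp [hB, hi]
  set M : ℝ → Fin n → Fin n → ℝ := fun ε j i => w i + ε * B j i with hM
  -- The rows of X are to be the dual basis. The first condition is det² · (w X⁻¹)_j > 0 without
  -- division, which keeps it open and forces invertibility.
  set U : Set (Fin n → Fin n → ℝ) :=
    {X | (∀ j, 0 < (Matrix.of X).det * (Matrix.vecMul w (Matrix.of X).adjugate) j) ∧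
      ∀ q ∈ T, ∀ j, 0 < ∑ i, X j i * (q i : ℝ)} with hU
  have hUopen : IsOpen U := by
    have hc : Continuous fun X : Fin n → Fin n → ℝ => Matrix.of X := continuous_id
    have h1 : ∀ j, IsOpen {X : Fin n → Fin n → ℝ |
        0 < (Matrix.of X).det * (Matrix.vecMul w (Matrix.of X).adjugate) j} := fun j =>
      isOpen_lt continuous_const (hc.matrix_det.mul
        ((continuous_apply j).comp (continuous_const.matrix_vecMul hc.matrix_adjugate)))
    have h2 : ∀ q : Fin n → ℤ, ∀ j, IsOpen {X : Fin n → Fin n → ℝ |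
        0 < ∑ i, X j i * (q i : ℝ)} := fun q j =>
      isOpen_lt continuous_const (by fun_prop)
    have : U = (⋂ j, {X : Fin n → Fin n → ℝ |
        0 < (Matrix.of X).det * (Matrix.vecMul w (Matrix.of X).adjugate) j}) ∩
        ⋂ q ∈ T, ⋂ j, {X : Fin n → Fin n → ℝ | 0 < ∑ i, X j i * (q i : ℝ)} := by
      ext X
      simp [hU]
    rw [this]
    exact (isOpen_iInter_of_finite h1).inter
      (isOpen_biInter_finset fun q _ => isOpen_iInter_of_finite (h2 q))
  have hUne : U.Nonempty := by
    have hev : ∀ᶠ ε in nhdsWithin (0 : ℝ) (Set.Ioi 0), ∀ q ∈ T, ∀ j,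
        0 < ∑ i, M ε j i * (q i : ℝ) := by
      rw [Filter.eventually_all_finset]
      intro q hq
      rw [Filter.eventually_all]
      intro j
      have hcont : Continuous fun ε : ℝ => ∑ i, M ε j i * (q i : ℝ) := by
        simp only [hM]
        fun_prop
      refine (hcont.tendsto 0).mono_left nhdsWithin_le_nhds |>.eventually_const_lt ?_
      simpa [hM, intWeight] using hT q hq
    obtain ⟨ε, hε, hpos⟩ := (hev.and self_mem_nhdsWithin).exists
    have hpos : 0 < ε := hpos
    refine ⟨M ε, fun j => ?_, hε⟩
    have hsum : ∀ i, ∑ j, M ε j i = n * w i := by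
      intro i
      simp [hM, Finset.sum_add_distrib, ← Finset.mul_sum, hBsum]
    have hvec : w = Matrix.vecMul (fun _ => (n : ℝ)⁻¹) (Matrix.of (M ε)) := by
      funext i
      simp only [Matrix.vecMul, dotProduct, Matrix.of_apply, ← Finset.mul_sum, hsum]
      field_simp
    -- For x in the kernel, summing rows gives w · x = 0; row j ≠ j₀ then gives ε x_j = 0, and
    -- finally w_{j₀} x_{j₀} = 0.
    have hdet : (Matrix.of (M ε)).det ≠ 0 := by
      intro h0
      obtain ⟨x, hx0, hx⟩ := Matrix.exists_mulVec_eq_zero_iff.2 h0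
      have hwx : ∑ i, w i * x i = 0 := by
        have h1 : ∑ j, ∑ i, M ε j i * x i = 0 :=
          Finset.sum_eq_zero fun j _ => congrFun hx j
        rw [Finset.sum_comm] at h1
        simp only [← Finset.sum_mul, hsum, mul_assoc, ← Finset.mul_sum] at h1
        exact (mul_eq_zero.1 h1).resolve_left hn.ne'
      have hxj : ∀ j, j ≠ j₀ → x j = 0 := by
        intro j hj
        have h1 : ∑ i, M ε j i * x i = 0 := congrFun hx j
        simp only [hM, hB, if_neg hj, add_mul, Finset.sum_add_distrib, hwx] at h1
        simpa [hpos.ne'] using h1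
      refine hx0 (funext fun j => ?_)
      by_cases hj : j = j₀
      · subst hj
        rw [Finset.sum_eq_single j (fun i _ hi => by rw [hxj i hi, mul_zero]) (by simp)] at hwx
        exact (mul_eq_zero.1 hwx).resolve_left hj₀
      · exact hxj j hj
    have h2 : Matrix.vecMul w (Matrix.of (M ε)).adjugate =
        (Matrix.of (M ε)).det • fun _ => (n : ℝ)⁻¹ := by
      conv_lhs => rw [hvec]
      rw [Matrix.vecMul_vecMul, Matrix.mul_adjugate, Matrix.vecMul_smul, Matrix.vecMul_one]
    rw [h2, Pi.smul_apply, smul_eq_mul, ← mul_assoc]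
    exact mul_pos (mul_self_pos.2 hdet) (inv_pos.2 hn)
  have hdense : DenseRange (Pi.map fun _ : Fin n => Pi.map fun _ : Fin n => (Rat.cast : ℚ → ℝ)) :=
    DenseRange.piMap fun _ => DenseRange.piMap fun _ => Rat.denseRange_cast
  obtain ⟨R, hR1, hR2⟩ := hdense.exists_mem_open hUopen hUne
  set Q : Matrix (Fin n) (Fin n) ℚ := Matrix.of R with hQ
  set c : ℚ →+* ℝ := Rat.castHom ℝ
  have hQc : Matrix.of ((Pi.map fun _ : Fin n => Pi.map fun _ : Fin n => (Rat.cast : ℚ → ℝ)) R) =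
      c.mapMatrix Q := rfl
  simp only [hQc, ← RingHom.map_det, ← RingHom.map_adjugate] at hR1
  have hdet : Q.det ≠ 0 := by
    intro h0
    have := hR1 j₀
    simp [h0] at this
  have hunit : IsUnit Q := (Matrix.isUnit_iff_isUnit_det Q).2 (isUnit_iff_ne_zero.2 hdet)
  have hli : LinearIndependent ℚ (Q⁻¹).col :=
    Matrix.linearIndependent_cols_iff_isUnit.2 ((Matrix.isUnit_nonsing_inv_iff).2 hunit)
  have : Nonempty (Fin n) := ⟨j₀⟩
  -- The basis consists of the columns of Q⁻¹, in which q has the positive coordinates Q q.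
  refine ⟨basisOfLinearIndependentOfCardEqFinrank hli (by simp), fun j => ?_, fun q hq => ?_⟩
  · rw [coe_basisOfLinearIndependentOfCardEqFinrank]
    have h1 : ∑ i, w i * ((Q⁻¹.col j i : ℚ) : ℝ) =
        (c Q.det)⁻¹ * (Matrix.vecMul w (c.mapMatrix Q.adjugate)) j := by
      rw [Matrix.vecMul, dotProduct, Finset.mul_sum]
      refine Finset.sum_congr rfl fun i _ => ?_
      simp only [Matrix.col_apply, Matrix.inv_def, Ring.inverse_eq_inv', Matrix.smul_apply,
        smul_eq_mul, Rat.cast_mul, Rat.cast_inv, RingHom.mapMatrix_apply, Matrix.map_apply]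
      simp only [c, Rat.coe_castHom]
      ring
    rw [h1]
    have h2 := hR1 j
    have h3 : c Q.det ≠ 0 := by simpa [c] using hdet
    have h4 : (c Q.det)⁻¹ * (Matrix.vecMul w (c.mapMatrix Q.adjugate)) j =
        (c Q.det * (Matrix.vecMul w (c.mapMatrix Q.adjugate)) j) * ((c Q.det)⁻¹ * (c Q.det)⁻¹) := by
      field_simp
    rw [h4]
    exact mul_pos h2 (mul_self_pos.2 (inv_ne_zero h3))
  · refine ⟨Q.mulVec fun i => (q i : ℚ), fun j => ?_, ?_⟩
    · have h1 : (0 : ℝ) < ∑ i, (R j i : ℝ) * (q i : ℝ) := hR2 q hq j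
      have h2 : (0 : ℚ) < ∑ i, R j i * (q i : ℚ) := by exact_mod_cast h1
      exact h2.le
    · rw [coe_basisOfLinearIndependentOfCardEqFinrank]
      have h1 : Matrix.mulVec Q⁻¹ (Q.mulVec fun i => (q i : ℚ)) = fun i => (q i : ℚ) := by
        rw [Matrix.mulVec_mulVec, Matrix.nonsing_inv_mul _ (isUnit_iff_ne_zero.2 hdet),
          Matrix.one_mulVec]
      funext i
      rw [← congrFun h1 i, Matrix.mulVec, dotProduct, Finset.sum_apply]
      exact Finset.sum_congr rfl fun j _ => by simp [mul_comm]

/-! ### The support of `φ_v` -/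

/-- If v_j is a nonnegative integer, so is v_j + u_j, and a bound q_j ≥ -(u_j)₊ keeps v_j + u_j +
q_j nonnegative. Thus no new negative coordinate appears, and minimality does the rest. -/
theorem mem_N_add [CharZero k] {A : Matrix (Fin d) (Fin n) ℤ} {v : Fin n → k}
    (hv : HasMinimalNegativeSupport A v) {u q : Fin n → ℤ} (hu : u ∈ N A v) (hq : q ∈ L A)
    (h : ∀ j, 0 ≤ ((u j).toNat : ℤ) + q j) : u + q ∈ N A v := by
  refine ⟨add_mem hu.1 hq, hv _ (add_mem hu.1 hq) ?_⟩
  have h1 := hu.2.subset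
  rw [← shift_zero v, shift_shift, nsupp_shift_subset_iff] at h1 ⊢
  intro j m hm hneg
  have := h1 j m hm
  have := h j
  simp only [zero_add, Pi.add_apply, Pi.zero_apply] at *
  omega

theorem zero_mem_N (A : Matrix (Fin d) (Fin n) ℤ) (v : Fin n → k) : 0 ∈ N A v :=
  ⟨zero_mem _, by rw [shift_zero]⟩

theorem mem_N_shift {A : Matrix (Fin d) (Fin n) ℤ} {v : Fin n → k} {u₀ u : Fin n → ℤ}
    (h₀ : u₀ ∈ N A v) (hu : u ∈ N A (shift v u₀)) : u₀ + u ∈ N A v :=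
  ⟨add_mem h₀.1 hu.1, by rw [← shift_shift, hu.2, h₀.2]⟩

theorem HasMinimalNegativeSupport.shift {A : Matrix (Fin d) (Fin n) ℤ} {v : Fin n → k}
    (hv : HasMinimalNegativeSupport A v) {u : Fin n → ℤ} (hu : u ∈ N A v) :
    HasMinimalNegativeSupport A (shift v u) := by
  intro z hz hsub
  rw [shift_shift, hu.2] at *
  exact hv _ (add_mem hu.1 hz) hsub

theorem exists_hasMinimalNegativeSupport (A : Matrix (Fin d) (Fin n) ℤ) (v : Fin n → k) :
    ∃ u ∈ L A, nsupp (shift v u) ⊆ nsupp v ∧ HasMinimalNegativeSupport A (shift v u) := by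
  obtain ⟨u, ⟨hu, hsub⟩, hmin⟩ := Set.Finite.exists_minimalFor' (fun u => nsupp (shift v u))
    {u | u ∈ L A ∧ nsupp (shift v u) ⊆ nsupp v} (Set.toFinite _)
    ⟨0, zero_mem _, by rw [shift_zero]⟩
  refine ⟨u, hu, hsub, fun z hz hle => hle.antisymm ?_⟩
  rw [shift_shift] at hle ⊢
  exact hmin ⟨add_mem hu hz, hle.trans hsub⟩ hle

theorem intWeight_eq_sum {A : Matrix (Fin d) (Fin n) ℤ} (w : Fin n → ℝ) (c : Fin d → ℝ)
    {u : Fin n → ℤ} (hu : u ∈ L A) :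
    intWeight w u = ∑ j, (w j - ∑ l, c l * (A l j : ℝ)) * (u j : ℝ) := by
  have h : ∑ j, (∑ l, c l * (A l j : ℝ)) * (u j : ℝ) = 0 := by
    simp only [Finset.sum_mul]
    rw [Finset.sum_comm]
    refine Finset.sum_eq_zero fun l _ => ?_
    have := congrArg (Int.cast : ℤ → ℝ) (mem_L.1 hu l)
    push_cast at this
    simp only [mul_assoc, ← Finset.mul_sum, this, mul_zero]
  simp only [sub_mul, Finset.sum_sub_distrib, h, sub_zero, intWeight]

/-- With w - c·A in place of w, coordinates in I do not count and the others are natural numbers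
with positive coefficients. The weights then lie in the image of ℕ^n under a monotone map. -/
theorem isPWO_intWeight_image [CharZero k] {A : Matrix (Fin d) (Fin n) ℤ} {w : Fin n → ℝ}
    {I : Finset (Fin n)} (hI : I ∈ regularTriangulation A w) {v : Fin n → k}
    (hneg : nsupp v ⊆ (I : Set (Fin n))) (hint : nonIntegral v ⊆ (I : Set (Fin n))) :
    (intWeight w '' N A v).IsPWO := by
  obtain ⟨c, hc1, hc2⟩ := hI
  have hm : ∀ j, ∃ m : ℤ, j ∉ I → v j = m := by
    intro j
    by_cases hj : j ∈ I
    · exact ⟨0, fun h => absurd hj h⟩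
    · obtain ⟨m, hm⟩ := not_not.1 fun h => hj (hint h)
      exact ⟨m, fun _ => hm⟩
  choose m hm using hm
  set δ : Fin n → ℝ := fun j => w j - ∑ l, c l * (A l j : ℝ) with hδ
  have hδI : ∀ j ∈ I, δ j = 0 := fun j hj => by simp [hδ, hc1 j hj]
  have hδ0 : ∀ j, 0 ≤ δ j := by
    intro j
    by_cases hj : j ∈ I
    · exact (hδI j hj).ge
    · exact (sub_pos.2 (hc2 j hj)).le
  set g : (Fin n → ℕ) → ℝ := fun e => ∑ j, δ j * (e j : ℝ) - ∑ j, δ j * (m j : ℝ) with hg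
  have hmono : Monotone g := by
    intro a b hab
    refine sub_le_sub_right (Finset.sum_le_sum fun j _ => ?_) _
    exact mul_le_mul_of_nonneg_left (by exact_mod_cast hab j) (hδ0 j)
  refine ((Set.isPWO_of_wellQuasiOrderedLE Set.univ).image_of_monotone hmono).mono ?_
  rintro _ ⟨u, hu, rfl⟩
  refine ⟨fun j => (m j + u j).toNat, trivial, ?_⟩
  rw [intWeight_eq_sum w c hu.1]
  simp only [hg, ← Finset.sum_sub_distrib, ← mul_sub]
  refine Finset.sum_congr rfl fun j _ => ?_
  by_cases hj : j ∈ I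
  · have := hδI j hj
    simp only [hδ] at this
    simp only [hδ, this, zero_mul]
  · have h1 : 0 ≤ m j + u j := by
      by_contra hlt
      have : j ∈ nsupp v := hu.2 ▸ (mem_nsupp_shift (hm j hj)).2 (not_le.1 hlt)
      exact hj (hneg this)
    have h2 : (((m j + u j).toNat : ℤ) : ℝ) = ((m j + u j : ℤ) : ℝ) := by
      rw [Int.toNat_of_nonneg h1]
    rw [Int.cast_natCast] at h2
    rw [h2]
    push_cast
    simp [hδ]

theorem IsGeneric.exists_intWeight_neg {A : Matrix (Fin d) (Fin n) ℤ} {w : Fin n → ℝ}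
    (hw : IsGeneric k A w) {p : Fin n → ℤ} (hp : p ∈ L A) (hp0 : p ≠ 0)
    (hwp : intWeight w p = 0) :
    ∃ q ∈ L A, intWeight w q < 0 ∧ ∀ j, 0 ≤ ((p j).toNat : ℤ) + q j := by
  obtain ⟨m, hm, hlt⟩ := hw.exists_weight_lt hp hp0 hwp
  refine ⟨fun j => (m j : ℤ) - (posPart p j : ℤ), mem_L.2 fun i => ?_, ?_, fun j => ?_⟩
  · simp only [mul_sub, Finset.sum_sub_distrib, hm, sub_self]
  · simp only [weight] at hlt
    simp only [intWeight, Int.cast_sub, Int.cast_natCast, mul_sub, Finset.sum_sub_distrib]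
    linarith
  · simp

/-- A nonzero u of weight zero could, by genericity, be moved inside N_v by a relation of negative
weight, below the minimum. -/
theorem intWeight_pos_of_mem_N [CharZero k] {A : Matrix (Fin d) (Fin n) ℤ} {w : Fin n → ℝ}
    (hw : IsGeneric k A w) {v : Fin n → k} (hv : HasMinimalNegativeSupport A v)
    (hmin : ∀ u ∈ N A v, 0 ≤ intWeight w u) {u : Fin n → ℤ} (hu : u ∈ N A v) (hu0 : u ≠ 0) :
    0 < intWeight w u := by
  refine lt_of_le_of_ne (hmin u hu) fun h0 => ?_
  obtain ⟨q, hq, hlt, hle⟩ := hw.exists_intWeight_neg hu.1 hu0 h0.symm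
  have := hmin _ (mem_N_add hv hu hq hle)
  rw [intWeight_add] at this
  linarith

/-- A finite set of relations of positive weight whose positive parts lie below those of all
relations of positive weight. -/
theorem exists_finset_posPart_le (A : Matrix (Fin d) (Fin n) ℤ) (w : Fin n → ℝ) :
    ∃ T : Finset (Fin n → ℤ), (∀ q ∈ T, q ∈ L A ∧ 0 < intWeight w q) ∧
      ∀ p ∈ L A, 0 < intWeight w p → ∃ q ∈ T, ∀ j, (q j).toNat ≤ (p j).toNat := by
  classical
  set P : Set (Fin n → ℕ) :=
    (fun (p : Fin n → ℤ) j => (p j).toNat) '' {p | p ∈ L A ∧ 0 < intWeight w p} with hP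
  -- Dickson's lemma: minimal elements form an antichain in ℕ^n.
  have hfin : {a | Minimal (· ∈ P) a}.Finite :=
    WellQuasiOrderedLE.finite_of_isAntichain (setOfPred_minimal_antichain _)
  have hch : ∀ a : Fin n → ℕ, ∃ p : Fin n → ℤ, a ∈ P →
      (p ∈ L A ∧ 0 < intWeight w p) ∧ (fun j => (p j).toNat) = a := by
    intro a
    by_cases ha : a ∈ P
    · obtain ⟨p, hp, h⟩ := ha
      exact ⟨p, fun _ => ⟨hp, h⟩⟩
    · exact ⟨0, fun h => absurd h ha⟩
  choose f hf using hch
  refine ⟨hfin.toFinset.image f, ?_, ?_⟩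
  · intro q hq
    obtain ⟨a, ha, rfl⟩ := Finset.mem_image.1 hq
    exact (hf a ((Set.Finite.mem_toFinset hfin).1 ha).prop).1
  · intro p hp hpos
    obtain ⟨b, hb, hbm⟩ := (Set.isPWO_of_wellQuasiOrderedLE P).exists_le_minimal
      (a := fun j => (p j).toNat) ⟨p, ⟨hp, hpos⟩, rfl⟩
    refine ⟨f b, Finset.mem_image_of_mem f ((Set.Finite.mem_toFinset hfin).2 hbm), fun j => ?_⟩
    have := congrFun (hf b hbm.prop).2 j
    exact this.trans_le (hb j)

/-- Descent on weight: if q in T has q₊ ≤ u₊, then u - q is again in N_v by `mem_N_add`, with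
smaller weight. Partial well-ordering of the weights ends the descent. -/
theorem exists_finset_N_subset_closure [CharZero k] {A : Matrix (Fin d) (Fin n) ℤ} {w : Fin n → ℝ}
    {v : Fin n → k} (hv : HasMinimalNegativeSupport A v)
    (hpwo : (intWeight w '' N A v).IsPWO)
    (hpos : ∀ u ∈ N A v, u ≠ 0 → 0 < intWeight w u) :
    ∃ T : Finset (Fin n → ℤ), (∀ q ∈ T, 0 < intWeight w q) ∧
      N A v ⊆ AddSubmonoid.closure (T : Set (Fin n → ℤ)) := by
  obtain ⟨T, hT, hTle⟩ := exists_finset_posPart_le A w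
  refine ⟨T, fun q hq => (hT q hq).2, fun u hu => ?_⟩
  refine Set.WellFoundedOn.induction (P := fun x => ∀ u ∈ N A v, intWeight w u = x →
    u ∈ AddSubmonoid.closure (T : Set (Fin n → ℤ))) hpwo.isWF
    (Set.mem_image_of_mem _ hu) ?_ u hu rfl
  rintro x - ih u hu rfl
  by_cases hu0 : u = 0
  · exact hu0 ▸ zero_mem _
  · obtain ⟨q, hq, hle⟩ := hTle u hu.1 (hpos u hu hu0)
    have hmem : u + -q ∈ N A v := mem_N_add hv hu (neg_mem (hT q hq).1) fun j => by
      have := hle j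
      simp only [Pi.neg_apply]
      omega
    have hlt : intWeight w (u + -q) < intWeight w u := by
      rw [intWeight_add, intWeight_neg]
      linarith [(hT q hq).2]
    have := add_mem (ih _ (Set.mem_image_of_mem _ hmem) hlt _ hmem rfl)
      (AddSubmonoid.subset_closure (Finset.mem_coe.2 hq))
    rwa [neg_add_cancel_right] at this

theorem inDirection_phi [CharZero k] {A : Matrix (Fin d) (Fin n) ℤ} {w : Fin n → ℝ} (hw : w ≠ 0)
    {v : Fin n → k} (hv : HasMinimalNegativeSupport A v)
    (hpwo : (intWeight w '' N A v).IsPWO)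
    (hpos : ∀ u ∈ N A v, u ≠ 0 → 0 < intWeight w u) :
    InDirection A w v (phi A v) := by
  obtain ⟨T, hT, hN⟩ := exists_finset_N_subset_closure hv hpwo hpos
  obtain ⟨b, hb, hbT⟩ := exists_basis_of_intWeight_pos hw T hT
  refine ⟨b, hb, fun α hα => ?_⟩
  obtain ⟨u, hu, rfl⟩ := exists_of_phi_ne_zero hα
  refine ⟨u, hu.1, rfl, ?_⟩
  have hcl : u ∈ AddSubmonoid.closure (T : Set (Fin n → ℤ)) := hN hu
  clear hα hu
  induction hcl using AddSubmonoid.closure_induction with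
  | mem x hx => exact hbT x hx
  | zero => exact ⟨0, fun _ => le_rfl, by ext; simp⟩
  | add x y _ _ hx hy =>
    obtain ⟨a, ha, hxa⟩ := hx
    obtain ⟨c, hc, hyc⟩ := hy
    refine ⟨a + c, fun j => add_nonneg (ha j) (hc j), ?_⟩
    simp only [Pi.add_apply, add_smul, Finset.sum_add_distrib, ← hxa, ← hyc]
    ext i
    simp

/-! ### Starting monomials and canonicity -/

theorem InDirection.intWeight_nonneg [CharZero k] {A : Matrix (Fin d) (Fin n) ℤ} {w : Fin n → ℝ}
    {v : Fin n → k} {f : LogSeries k n} (h : InDirection A w v f) {u : Fin n → ℤ}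
    (hu : f (shift v u) ≠ 0) : 0 ≤ intWeight w u := by
  obtain ⟨b, hb, h⟩ := h
  obtain ⟨u', -, he, c, hc, hcu⟩ := h _ hu
  obtain rfl := shift_injective v he
  have h1 : ∀ i, (u i : ℝ) = ∑ j, (c j : ℝ) * (b j i : ℝ) := by
    intro i
    have := congrArg (Rat.cast : ℚ → ℝ) (congrFun hcu i)
    simpa using this
  simp only [intWeight, h1, Finset.mul_sum]
  rw [Finset.sum_comm]
  refine Finset.sum_nonneg fun j _ => ?_
  have h2 : ∑ i, w i * ((c j : ℝ) * (b j i : ℝ)) = c j * ∑ i, w i * (b j i : ℝ) := by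
    rw [Finset.mul_sum]
    exact Finset.sum_congr rfl fun i _ => by ring
  rw [h2]
  exact mul_nonneg (by exact_mod_cast hc j) (hb j).le

/-- If `f` is a solution in the direction of `w` starting with `c • x^v`, `c ≠ 0`, then `∂^{u₊}`
annihilates `x^v` for every relation `u` of positive weight. -/
theorem fallingProd_posPart_eq_zero [CharZero k] {A : Matrix (Fin d) (Fin n) ℤ} {β : Fin d → k}
    {w : Fin n → ℝ} {v : Fin n → k} {f : LogSeries k n} (hf : IsHypergeometric A β f)
    (hdir : InDirection A w v f) {c : k} (hc : c ≠ 0) (hfv : f v = MvPolynomial.C c)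
    {u : Fin n → ℤ} (hu : u ∈ L A) (hpos : 0 < intWeight w u) :
    fallingProd v (posPart u) = 0 := by
  have hu0 : u ≠ 0 := by
    rintro rfl
    simp [intWeight] at hpos
  have h1 := hf _ (Ideal.subset_span (Or.inl ⟨_, binomial_mem_toricIdeal (k := k) hu, rfl⟩))
  rw [act_ofPoly, support_binomial (posPart_ne hu0), Finset.sum_pair (posPart_ne hu0)] at h1
  simp only [MvPolynomial.coeff_sub, MvPolynomial.coeff_monomial, if_pos, posPart_ne hu0,
    (posPart_ne hu0).symm, if_false, sub_zero, zero_sub, one_smul, neg_smul] at h1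
  -- At the exponent v - u₊, the operator ∂^{u₊} sees f at v, while ∂^{u₋} sees f at v - u, where f
  -- vanishes for its negative weight.
  have h2 := congrFun h1 (fun j => v j - (posPart u j : k))
  have e1 : (fun j => v j - (posPart u j : k) + (posPart u j : k)) = v := by simp
  have e2 : (fun j => v j - (posPart u j : k) + (posPart (-u) j : k)) = shift v (-u) := by
    funext j
    have := congrArg (Int.cast : ℤ → k) (posPart_sub_posPart_neg u j)
    push_cast at this
    simp only [shift, Pi.neg_apply, Int.cast_neg, ← this]
    ring
  have h3 : f (shift v (-u)) = 0 := by
    by_contra hne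
    have := hdir.intWeight_nonneg hne
    rw [intWeight_neg] at this
    linarith
  rw [Pi.add_apply, Pi.neg_apply, act_delPow_apply (by rw [e1]; exact hfv),
    act_delPow_apply (c := 0) (by rw [e2, h3, map_zero]), mul_zero, map_zero, neg_zero, add_zero,
    Pi.zero_apply, e1, map_eq_zero_iff _ (MvPolynomial.C_injective _ _)] at h2
  exact (mul_eq_zero.1 h2).resolve_right hc

theorem isCanonical_phi [CharZero k] {A : Matrix (Fin d) (Fin n) ℤ} {β : Fin d → k}
    {w : Fin n → ℝ} {v : Fin n → k} (hhyp : IsHypergeometric A β (phi A v))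
    (hdir : InDirection A w v (phi A v))
    (hpos : ∀ u ∈ N A v, u ≠ 0 → 0 < intWeight w u) :
    IsCanonical A β w v (phi A v) := by
  refine ⟨hhyp, hdir, by rw [phi_self]; exact one_ne_zero, ?_⟩
  rintro v' e ⟨f, hf, hfdir, hf0, he⟩ hcoeff
  have hne : phi A v v' ≠ 0 := by
    intro h
    simp [h] at hcoeff
  obtain ⟨u, hu, rfl⟩ := exists_of_phi_ne_zero hne
  rw [phi_shift v hu.1, MvPolynomial.coeff_C] at hcoeff
  have he0 : e = 0 := by
    by_contra h
    exact hcoeff (if_neg (Ne.symm h))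
  rw [phi_self, MonomialOrder.degree_one]
  refine ⟨?_, he0⟩
  by_cases hu0 : u = 0
  · rw [hu0, shift_zero]
  exfalso
  have hC := MonomialOrder.eq_C_of_degree_eq_zero (he.symm.trans he0)
  have hc0 : MonomialOrder.lex.leadingCoeff (f (shift v u)) ≠ 0 := by
    intro h
    rw [h, map_zero] at hC
    exact hf0 hC
  have hz := fallingProd_posPart_eq_zero hf hfdir hc0 hC hu.1 (hpos u hu hu0)
  obtain ⟨j, t, ht, hj⟩ := fallingProd_eq_zero_iff.1 hz
  rw [posPart_apply] at ht
  have hvj : v j = ((t - u j : ℤ) : k) := by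
    simp only [shift] at hj
    push_cast
    rw [← hj]
    ring
  have h1 : j ∈ nsupp v := (mem_nsupp_iff hvj).2 (by omega)
  rw [← hu.2, mem_nsupp_shift hvj] at h1
  omega

/-! ### Lattices and spaces spanned by columns -/

/-- The vector in `k^d` with the given rational coordinates. -/
def castVec (k : Type*) [Field k] (x : Fin d → ℚ) : Fin d → k := fun i => (x i : k)

theorem castVec_col (A : Matrix (Fin d) (Fin n) ℤ) (j : Fin n) :
    castVec k (col ℚ A j) = col k A j := by
  funext i; simp [castVec, col]

theorem castVec_image (A : Matrix (Fin d) (Fin n) ℤ) (J : Set (Fin n)) :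
    castVec k '' (col ℚ A '' J) = col k A '' J := by
  rw [Set.image_image]
  simp only [castVec_col]

theorem castVec_mem_span [CharZero k] {S : Set (Fin d → ℚ)} {x : Fin d → ℚ}
    (hx : x ∈ Submodule.span ℚ S) : castVec k x ∈ Submodule.span k (castVec k '' S) := by
  induction hx using Submodule.span_induction with
  | mem x hx => exact Submodule.subset_span (Set.mem_image_of_mem _ hx)
  | zero =>
    have : castVec k (0 : Fin d → ℚ) = 0 := by funext i; simp [castVec]
    rw [this]; exact zero_mem _
  | add x y _ _ hx hy =>
    have : castVec k (x + y) = castVec k x + castVec k y := by funext i; simp [castVec]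
    rw [this]; exact add_mem hx hy
  | smul c x _ hx =>
    have : castVec k (c • x) = (c : k) • castVec k x := by funext i; simp [castVec]
    rw [this]; exact Submodule.smul_mem _ _ hx

/-- A rational functional that vanishes on S but not at x keeps both properties after extension of
scalars to k. -/
theorem mem_span_of_castVec_mem [CharZero k] {S : Set (Fin d → ℚ)} {x : Fin d → ℚ}
    (hx : castVec k x ∈ Submodule.span k (castVec k '' S)) : x ∈ Submodule.span ℚ S := by
  by_contra hcon
  obtain ⟨f, hf, hle⟩ := Submodule.exists_le_ker_of_notMem hcon
  have hfx : ∀ y : Fin d → ℚ, f y = ∑ i, y i * f (Pi.single i 1) := by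
    intro y
    conv_lhs => rw [← Finset.univ_sum_single y, map_sum]
    refine Finset.sum_congr rfl fun i _ => ?_
    rw [← smul_eq_mul, ← map_smul, ← Pi.single_smul, smul_eq_mul, mul_one]
  set F : (Fin d → k) →ₗ[k] k :=
    ∑ i, ((f (Pi.single i 1) : ℚ) : k) • LinearMap.proj (R := k) (φ := fun _ : Fin d => k) i with hF
  have hFc : ∀ y : Fin d → ℚ, F (castVec k y) = (f y : k) := by
    intro y
    rw [hfx y]
    simp [hF, castVec, LinearMap.sum_apply, mul_comm]
  have hker : Submodule.span k (castVec k '' S) ≤ F.ker := by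
    rw [Submodule.span_le]
    rintro _ ⟨y, hy, rfl⟩
    have : f y = 0 := hle (Submodule.subset_span hy)
    simp [hFc, this]
  have h0 := hker hx
  rw [LinearMap.mem_ker, hFc] at h0
  exact hf (by exact_mod_cast h0)

theorem exists_nsmul_castVec_mem_latticeOf [CharZero k] {A : Matrix (Fin d) (Fin n) ℤ}
    {J : Set (Fin n)} {x : Fin d → ℚ} (hx : x ∈ Submodule.span ℚ (col ℚ A '' J)) :
    ∃ N : ℕ, 0 < N ∧ N • castVec k x ∈ latticeOf k A J := by
  induction hx using Submodule.span_induction with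
  | mem x hx =>
    obtain ⟨j, hj, rfl⟩ := hx
    refine ⟨1, one_pos, ?_⟩
    rw [one_smul, castVec_col]
    exact AddSubgroup.subset_closure ⟨j, hj, rfl⟩
  | zero =>
    have : castVec k (0 : Fin d → ℚ) = 0 := by funext i; simp [castVec]
    exact ⟨1, one_pos, by rw [this, smul_zero]; exact zero_mem _⟩
  | add x y _ _ hx hy =>
    obtain ⟨a, ha, hxa⟩ := hx
    obtain ⟨b, hb, hyb⟩ := hy
    refine ⟨a * b, Nat.mul_pos ha hb, ?_⟩
    have : (a * b) • castVec k (x + y) = b • a • castVec k x + a • b • castVec k y := by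
      funext i; simp [castVec]; ring
    rw [this]
    exact add_mem (nsmul_mem hxa b) (nsmul_mem hyb a)
  | smul c x _ hx =>
    obtain ⟨a, ha, hxa⟩ := hx
    refine ⟨a * c.den, Nat.mul_pos ha c.den_pos, ?_⟩
    have : (a * c.den) • castVec k (c • x) = c.num • a • castVec k x := by
      funext i
      have h1 : (c : k) * (c.den : k) = (c.num : k) := by
        exact_mod_cast congrArg (Rat.cast : ℚ → k) (Rat.mul_den_eq_num c)
      simp [castVec, ← h1]; ring
    rw [this]
    exact zsmul_mem hxa _

theorem exists_nsmul_mem_latticeOf [CharZero k] {A : Matrix (Fin d) (Fin n) ℤ}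
    {J F : Set (Fin n)} (hF : ∀ j ∈ F, col ℚ A j ∈ Submodule.span ℚ (col ℚ A '' J))
    {z : Fin d → k} (hz : z ∈ latticeOf k A F) : ∃ N : ℕ, 0 < N ∧ N • z ∈ latticeOf k A J := by
  induction hz using AddSubgroup.closure_induction with
  | mem x hx =>
    obtain ⟨j, hj, rfl⟩ := hx
    rw [← castVec_col]
    exact exists_nsmul_castVec_mem_latticeOf (hF j hj)
  | zero => exact ⟨1, one_pos, by rw [smul_zero]; exact zero_mem _⟩
  | add x y _ _ hx hy =>
    obtain ⟨a, ha, hxa⟩ := hx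
    obtain ⟨b, hb, hyb⟩ := hy
    refine ⟨a * b, Nat.mul_pos ha hb, ?_⟩
    rw [smul_add, mul_comm a b, mul_smul, mul_comm b a, mul_smul]
    exact add_mem (nsmul_mem hxa b) (nsmul_mem hyb a)
  | neg x _ hx =>
    obtain ⟨a, ha, hxa⟩ := hx
    exact ⟨a, ha, by rw [smul_neg]; exact neg_mem hxa⟩

/-- The quotient is finitely generated, and torsion by clearing denominators. -/
theorem finite_latticeOf_quotient [CharZero k] {A : Matrix (Fin d) (Fin n) ℤ}
    {J F : Set (Fin n)} (hF : ∀ j ∈ F, col ℚ A j ∈ Submodule.span ℚ (col ℚ A '' J)) :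
    Finite (latticeOf k A F ⧸ (latticeOf k A J).addSubgroupOf (latticeOf k A F)) := by
  have : AddGroup.FG (latticeOf k A F) :=
    AddGroup.closure_finite_fg (col k A '' F)
  refine AddCommGroup.finite_of_fg_isAddTorsion _ ?_
  intro g
  obtain ⟨z, rfl⟩ := QuotientAddGroup.mk_surjective g
  obtain ⟨N, hN, hz⟩ := exists_nsmul_mem_latticeOf hF z.2
  refine isOfFinAddOrder_iff_nsmul_eq_zero.2 ⟨N, hN, ?_⟩
  rw [← QuotientAddGroup.mk_nsmul, QuotientAddGroup.eq_zero_iff, AddSubgroup.mem_addSubgroupOf]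
  exact hz

theorem applyA_add (A : Matrix (Fin d) (Fin n) ℤ) (a b : Fin n → k) :
    applyA A (a + b) = applyA A a + applyA A b := by
  simp [applyA, add_smul, Finset.sum_add_distrib]

theorem applyA_nsmul (A : Matrix (Fin d) (Fin n) ℤ) (N : ℕ) (a : Fin n → k) :
    applyA A (N • a) = N • applyA A a := by
  simp [applyA, Finset.smul_sum, mul_smul, Nat.cast_smul_eq_nsmul]

theorem applyA_single (A : Matrix (Fin d) (Fin n) ℤ) (j : Fin n) :
    applyA A (Pi.single j 1 : Fin n → k) = col k A j := by
  rw [applyA, Finset.sum_eq_single j (fun i _ hi => by simp [hi]) (by simp)]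
  simp

/-- An exponent vector as a vector in `k^n`. -/
def natVec (k : Type*) [Field k] (e : Fin n → ℕ) : Fin n → k := fun j => (e j : k)

theorem natVec_add (a b : Fin n → ℕ) : natVec k (a + b) = natVec k a + natVec k b := by
  funext j; simp [natVec]

theorem natVec_nsmul (N : ℕ) (a : Fin n → ℕ) : natVec k (N • a) = N • natVec k a := by
  funext j; simp [natVec]

theorem natVec_zero : natVec k (0 : Fin n → ℕ) = 0 := by
  funext j; simp [natVec]

theorem natVec_single (j : Fin n) :
    natVec k (Pi.single j 1 : Fin n → ℕ) = Pi.single j 1 := by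
  funext i
  by_cases h : i = j
  · subst h; simp [natVec]
  · simp [natVec, h]

theorem applyA_zero (A : Matrix (Fin d) (Fin n) ℤ) : applyA A (0 : Fin n → k) = 0 := by
  simp [applyA]

theorem exists_natVec_of_mem_monoidOf {A : Matrix (Fin d) (Fin n) ℤ} {m : Fin d → k}
    (hm : m ∈ monoidOf k A) : ∃ e : Fin n → ℕ, m = applyA A (natVec k e) := by
  induction hm using AddSubmonoid.closure_induction with
  | mem x hx =>
    obtain ⟨j, rfl⟩ := hx
    exact ⟨Pi.single j 1, by rw [natVec_single, applyA_single]⟩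
  | zero => exact ⟨0, by rw [natVec_zero, applyA_zero]⟩
  | add x y _ _ hx hy =>
    obtain ⟨a, rfl⟩ := hx
    obtain ⟨b, rfl⟩ := hy
    exact ⟨a + b, by rw [natVec_add, applyA_add]⟩

/-- If `ℤJ` has finite index in `ℤF`, every coset of `ℤJ` in `ℤF` meets `ℕA`. -/
theorem exists_natVec_sub_mem_latticeOf [CharZero k] {A : Matrix (Fin d) (Fin n) ℤ}
    {J F : Set (Fin n)} (hF : ∀ j ∈ F, col ℚ A j ∈ Submodule.span ℚ (col ℚ A '' J))
    {z : Fin d → k} (hz : z ∈ latticeOf k A F) :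
    ∃ e : Fin n → ℕ, z - applyA A (natVec k e) ∈ latticeOf k A J := by
  induction hz using AddSubgroup.closure_induction with
  | mem x hx =>
    obtain ⟨j, -, rfl⟩ := hx
    exact ⟨Pi.single j 1, by rw [natVec_single, applyA_single, sub_self]; exact zero_mem _⟩
  | zero => exact ⟨0, by rw [natVec_zero, applyA_zero, sub_self]; exact zero_mem _⟩
  | add x y _ _ hx hy =>
    obtain ⟨a, ha⟩ := hx
    obtain ⟨b, hb⟩ := hy
    refine ⟨a + b, ?_⟩
    rw [natVec_add, applyA_add, add_sub_add_comm]
    exact add_mem ha hb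
  | neg x hx ih =>
    obtain ⟨a, ha⟩ := ih
    obtain ⟨N, hN, hNx⟩ := exists_nsmul_mem_latticeOf hF (show x ∈ latticeOf k A F from hx)
    obtain ⟨M, rfl⟩ : ∃ M, N = M + 1 := ⟨N - 1, by omega⟩
    -- Since (M + 1)x lies in ℤJ, -x is congruent to M x, which avoids the sign.
    refine ⟨M • a, ?_⟩
    rw [natVec_nsmul, applyA_nsmul]
    have : -x - M • applyA A (natVec k a) =
        M • (x - applyA A (natVec k a)) - (M + 1) • x := by
      rw [smul_sub, add_smul, one_smul]; abel
    rw [this]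
    exact sub_mem (nsmul_mem ha M) hNx

/-! ### Faces of the cone -/

theorem col_mem_cone (A : Matrix (Fin d) (Fin n) ℤ) (j : Fin n) : col ℚ A j ∈ cone A :=
  PointedCone.subset_hull ⟨j, rfl⟩

/-- An element of the span is a difference s - t in τ; from x + t = s the face property puts x in τ.
-/
theorem mem_face_of_mem_span {C τ : PointedCone ℚ (Fin d → ℚ)} (hτ : τ.IsFaceOf C)
    {x : Fin d → ℚ} (hx : x ∈ C) (hspan : x ∈ Submodule.span ℚ (τ : Set (Fin d → ℚ))) :
    x ∈ τ := by
  have key : ∃ s ∈ τ, ∃ t ∈ τ, x + t = s := by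
    clear hx
    induction hspan using Submodule.span_induction with
    | mem x hx => exact ⟨x, hx, 0, zero_mem _, add_zero x⟩
    | zero => exact ⟨0, zero_mem _, 0, zero_mem _, add_zero _⟩
    | add x y _ _ hx hy =>
      obtain ⟨s, hs, t, ht, h⟩ := hx
      obtain ⟨s', hs', t', ht', h'⟩ := hy
      exact ⟨s + s', add_mem hs hs', t + t', add_mem ht ht', by rw [← h, ← h']; abel⟩
    | smul c x _ hx =>
      obtain ⟨s, hs, t, ht, h⟩ := hx
      rcases le_total 0 c with hc | hc
      · exact ⟨c • s, τ.smul_mem hc hs, c • t, τ.smul_mem hc ht, by rw [← h, smul_add]⟩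
      · have hc' : 0 ≤ -c := neg_nonneg.2 hc
        refine ⟨(-c) • t, τ.smul_mem hc' ht, (-c) • s, τ.smul_mem hc' hs, ?_⟩
        rw [← h, smul_add, neg_smul, neg_smul]
        abel
  obtain ⟨s, hs, t, ht, h⟩ := key
  exact hτ.mem_of_add_mem_left hx (hτ.le ht) (h ▸ hs)

variable {A : Matrix (Fin d) (Fin n) ℤ} {τ : PointedCone ℚ (Fin d → ℚ)} {I : Finset (Fin n)}

theorem subset_indicesIn (hτ : τ.IsFaceOf (cone A))
    (hspan : Submodule.span ℚ (τ : Set (Fin d → ℚ)) =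
      Submodule.span ℚ (col ℚ A '' (I : Set (Fin n)))) : (I : Set (Fin n)) ⊆ indicesIn A τ :=
  fun i hi => mem_face_of_mem_span hτ (col_mem_cone A i)
    (hspan ▸ Submodule.subset_span ⟨i, hi, rfl⟩)

theorem col_mem_span_of_mem_indicesIn
    (hspan : Submodule.span ℚ (τ : Set (Fin d → ℚ)) =
      Submodule.span ℚ (col ℚ A '' (I : Set (Fin n)))) :
    ∀ j ∈ indicesIn A τ, col ℚ A j ∈ Submodule.span ℚ (col ℚ A '' (I : Set (Fin n))) :=
  fun _ hj => hspan ▸ Submodule.subset_span hj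

theorem spaceOf_indicesIn [CharZero k] (hτ : τ.IsFaceOf (cone A))
    (hspan : Submodule.span ℚ (τ : Set (Fin d → ℚ)) =
      Submodule.span ℚ (col ℚ A '' (I : Set (Fin n)))) :
    spaceOf k A (indicesIn A τ) = spaceOf k A (I : Set (Fin n)) := by
  refine le_antisymm (Submodule.span_le.2 ?_)
    (Submodule.span_mono (Set.image_mono (subset_indicesIn hτ hspan)))
  rintro _ ⟨j, hj, rfl⟩
  have := castVec_mem_span (k := k) (col_mem_span_of_mem_indicesIn hspan j hj)
  rwa [castVec_col, castVec_image] at this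

/-- The membership descends from k to ℚ, so ∑ e_j a_j lies in the cone and in ℚτ, hence in the face
τ; so does each column used. -/
theorem mem_indicesIn_of_applyA_mem [CharZero k] (hτ : τ.IsFaceOf (cone A))
    (hspan : Submodule.span ℚ (τ : Set (Fin d → ℚ)) =
      Submodule.span ℚ (col ℚ A '' (I : Set (Fin n)))) {e : Fin n → ℕ}
    (he : applyA A (natVec k e) ∈ spaceOf k A (indicesIn A τ)) {j : Fin n} (hj : 0 < e j) :
    j ∈ indicesIn A τ := by
  set x : Fin d → ℚ := ∑ j, (e j : ℚ) • col ℚ A j with hx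
  have hxe : castVec k x = applyA A (natVec k e) := by
    funext i
    simp [castVec, hx, applyA_apply, natVec, col]
  rw [spaceOf_indicesIn hτ hspan, ← hxe, spaceOf, ← castVec_image] at he
  have h1 := mem_span_of_castVec_mem he
  rw [← hspan] at h1
  have hxC : x ∈ cone A :=
    Submodule.sum_mem _ fun j _ => (cone A).smul_mem (Nat.cast_nonneg _) (col_mem_cone A j)
  have h2 := mem_face_of_mem_span hτ hxC h1
  exact hτ.mem_of_sum_smul_mem (c := fun j => (e j : ℚ)) (col_mem_cone A)
    (fun j => Nat.cast_nonneg _) h2 j (Nat.cast_pos.2 hj)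

theorem latticeOf_le_spaceOf (J : Set (Fin n)) {z : Fin d → k} (hz : z ∈ latticeOf k A J) :
    z ∈ spaceOf k A J := by
  have : latticeOf k A J ≤ (spaceOf k A J).toAddSubgroup := by
    rw [latticeOf, AddSubgroup.closure_le]
    exact Submodule.subset_span
  exact this hz

/-- Each class comes from some β - A e with e zero on F. If two such e were comparable, their
difference c would have A c in kF, hence support in F, where c vanishes. -/
theorem finite_E [CharZero k] (β : Fin d → k) (hτ : τ.IsFaceOf (cone A))
    (hspan : Submodule.span ℚ (τ : Set (Fin d → ℚ)) =
      Submodule.span ℚ (col ℚ A '' (I : Set (Fin n)))) : (E A β τ).Finite := by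
  classical
  set R : Set (Fin n → ℕ) := {e | (∀ j ∈ indicesIn A τ, e j = 0) ∧
    β - applyA A (natVec k e) ∈ spaceOf k A (indicesIn A τ)} with hR
  have hanti : IsAntichain (· ≤ ·) R := by
    intro a ha b hb hne hle
    refine hne (funext fun j => (hle j).antisymm ?_)
    by_contra hlt
    push Not at hlt
    obtain ⟨c, rfl⟩ : ∃ c, b = a + c := ⟨b - a, (add_tsub_cancel_of_le hle).symm⟩
    have hc : applyA A (natVec k c) ∈ spaceOf k A (indicesIn A τ) := by
      have := sub_mem ha.2 hb.2
      rw [natVec_add, applyA_add] at this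
      convert this using 1
      abel
    have hj : j ∈ indicesIn A τ :=
      mem_indicesIn_of_applyA_mem hτ hspan hc (by simpa using hlt)
    exact hlt.not_ge ((hb.1 j hj).trans_le (Nat.zero_le _))
  have hfin : R.Finite := WellQuasiOrderedLE.finite_of_isAntichain hanti
  refine (hfin.image fun e => QuotientAddGroup.mk (β - applyA A (natVec k e))).subset ?_
  rintro _ ⟨l, hl, rfl, m, hm, z, hz, h⟩
  obtain ⟨e, rfl⟩ := exists_natVec_of_mem_monoidOf hm
  set e₁ : Fin n → ℕ := fun j => if j ∈ indicesIn A τ then e j else 0 with he₁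
  set e₂ : Fin n → ℕ := fun j => if j ∈ indicesIn A τ then 0 else e j with he₂
  have he : e = e₁ + e₂ := by
    funext j
    by_cases hj : j ∈ indicesIn A τ <;> simp [he₁, he₂, hj]
  have h1 : applyA A (natVec k e₁) ∈ latticeOf k A (indicesIn A τ) := by
    refine sum_mem fun j _ => ?_
    by_cases hj : j ∈ indicesIn A τ
    · simp only [natVec, Nat.cast_smul_eq_nsmul]
      exact nsmul_mem (AddSubgroup.subset_closure (Set.mem_image_of_mem _ hj)) _
    · simp [natVec, he₁, hj]
  rw [he, natVec_add, applyA_add] at h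
  have h2 : β - applyA A (natVec k e₂) = l + (applyA A (natVec k e₁) + z) := by
    rw [sub_eq_iff_eq_add] at h ⊢
    rw [h]; abel
  have h3 := add_mem h1 hz
  refine ⟨e₂, ⟨fun j hj => by simp [he₂, hj], ?_⟩, ?_⟩
  · rw [h2]
    exact add_mem hl (latticeOf_le_spaceOf _ h3)
  · simp only [h2]
    rw [QuotientAddGroup.mk_add, (QuotientAddGroup.eq_zero_iff _).2 h3, add_zero]

/-! ### Exponents -/

theorem exists_natCast_of_supports {J : Set (Fin n)} {v : Fin n → k} (hneg : nsupp v ⊆ J)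
    (hint : nonIntegral v ⊆ J) {j : Fin n} (hj : j ∉ J) : ∃ e : ℕ, v j = (e : k) := by
  obtain ⟨m, hm⟩ := not_not.1 fun h => hj (hint h)
  have h0 : 0 ≤ m := by
    by_contra hlt
    exact hj (hneg ⟨m, not_le.1 hlt, hm⟩)
  obtain ⟨e, rfl⟩ := Int.eq_ofNat_of_zero_le h0
  exact ⟨e, by rw [hm, Int.cast_natCast]⟩

/-- The part `∑_{i ∈ I} v_i a_i` of `A v`. -/
def vertexSum (A : Matrix (Fin d) (Fin n) ℤ) (I : Finset (Fin n)) (v : Fin n → k) : Fin d → k :=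
  ∑ i ∈ I, v i • col k A i

theorem vertexSum_shift_sub_mem (v : Fin n → k) (u : Fin n → ℤ) :
    vertexSum A I (shift v u) - vertexSum A I v ∈ latticeOf k A (I : Set (Fin n)) := by
  rw [vertexSum, vertexSum, ← Finset.sum_sub_distrib]
  refine sum_mem fun i hi => ?_
  rw [← sub_smul, shift, add_sub_cancel_left, Int.cast_smul_eq_zsmul]
  exact zsmul_mem (AddSubgroup.subset_closure (Set.mem_image_of_mem _ (Finset.mem_coe.2 hi))) _

/-- Every `x ∈ k(A ∩ τ)` with `β - x ∈ ℕA + ℤ(A ∩ τ)` is, modulo `ℤI`, the vertex part of a vector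
`v` with `A v = β` whose coordinates outside `I` are natural numbers. -/
theorem exists_applyA_eq [CharZero k] {β : Fin d → k} (hτ : τ.IsFaceOf (cone A))
    (hspan : Submodule.span ℚ (τ : Set (Fin d → ℚ)) =
      Submodule.span ℚ (col ℚ A '' (I : Set (Fin n))))
    {x : Fin d → k} (hx : x ∈ spaceOf k A (indicesIn A τ))
    {m : Fin d → k} (hm : m ∈ monoidOf k A) {z : Fin d → k}
    (hz : z ∈ latticeOf k A (indicesIn A τ)) (h : β - x = m + z) :
    ∃ v : Fin n → k, applyA A v = β ∧ nsupp v ⊆ (I : Set (Fin n)) ∧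
      nonIntegral v ⊆ (I : Set (Fin n)) ∧
      vertexSum A I v - x ∈ latticeOf k A (I : Set (Fin n)) := by
  classical
  obtain ⟨e₁, rfl⟩ := exists_natVec_of_mem_monoidOf hm
  obtain ⟨e₂, he₂⟩ := exists_natVec_sub_mem_latticeOf (col_mem_span_of_mem_indicesIn hspan) hz
  -- Since y lies in ℤI, it can be moved to the vertex part without changing the class modulo ℤI;
  -- the rest m + A e₂ of β lies in ℕA.
  set y := z - applyA A (natVec k e₂) with hy
  have hxy : x + y ∈ spaceOf k A (I : Set (Fin n)) :=
    add_mem (spaceOf_indicesIn (k := k) hτ hspan ▸ hx) (latticeOf_le_spaceOf _ he₂)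
  obtain ⟨t, htI, ht⟩ : ∃ t : Fin n → k, (∀ j ∉ I, t j = 0) ∧ applyA A t = x + y := by
    rw [spaceOf, Submodule.mem_span_image_finset_iff_exists_fun] at hxy
    obtain ⟨c, hc⟩ := hxy
    refine ⟨fun j => if h : j ∈ I then c ⟨j, h⟩ else 0, fun j hj => dif_neg hj, ?_⟩
    rw [← hc, applyA, ← Finset.sum_subset (Finset.subset_univ I) fun j _ hj => by simp [hj],
      ← Finset.sum_coe_sort]
    exact Finset.sum_congr rfl fun j _ => by simp
  have htv : vertexSum A I t = x + y := by
    rw [← ht, applyA, vertexSum]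
    exact Finset.sum_subset (Finset.subset_univ I) fun j _ hj => by rw [htI j hj, zero_smul]
  set v := t + natVec k (e₁ + e₂) with hv
  have hnat : ∀ j, j ∉ I → v j = ((e₁ j + e₂ j : ℕ) : k) := fun j hj => by
    simp [hv, htI j hj, natVec]
  refine ⟨v, ?_, ?_, ?_, ?_⟩
  · rw [hv, natVec_add, applyA_add, applyA_add, ht, hy, ← add_sub_cancel x β, h]
    abel
  · rintro j ⟨m, hm, hj⟩
    by_contra hjI
    rw [hnat j hjI] at hj
    have : ((e₁ j + e₂ j : ℕ) : ℤ) = m := by exact_mod_cast hj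
    omega
  · intro j hj
    by_contra hjI
    exact hj ⟨((e₁ j + e₂ j : ℕ) : ℤ), by rw [hnat j hjI, Int.cast_natCast]⟩
  · have h1 : v = shift t fun j => ((e₁ j + e₂ j : ℕ) : ℤ) := by
      funext j
      simp [hv, shift, natVec]
    have h2 := vertexSum_shift_sub_mem (A := A) (I := I) t fun j => ((e₁ j + e₂ j : ℕ) : ℤ)
    rw [← h1, htv] at h2
    have h3 := add_mem h2 he₂
    convert h3 using 1
    abel

/-- A translate of `v` by `L` has minimal negative support and minimal weight among the exponents
of its series. -/
theorem exists_shift_minimal [CharZero k] {w : Fin n → ℝ} (hw : IsGeneric k A w)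
    (hI : I ∈ regularTriangulation A w) {v : Fin n → k}
    (hneg : nsupp v ⊆ (I : Set (Fin n))) (hint : nonIntegral v ⊆ (I : Set (Fin n))) :
    ∃ u ∈ L A, nsupp (shift v u) ⊆ (I : Set (Fin n)) ∧
      HasMinimalNegativeSupport A (shift v u) ∧
      ∀ z ∈ N A (shift v u), z ≠ 0 → 0 < intWeight w z := by
  obtain ⟨u₁, hu₁, hsub, hmin⟩ := exists_hasMinimalNegativeSupport A v
  have hpwo := isPWO_intWeight_image (A := A) hI (hsub.trans hneg)
    ((nonIntegral_shift v u₁).trans_subset hint)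
  obtain ⟨u₂, hu₂, hle⟩ := Set.IsPWO.exists_minimalFor (intWeight w) (N A (shift v u₁)) hpwo
    ⟨0, zero_mem_N A _⟩
  have hmin₂ := hmin.shift hu₂
  refine ⟨u₁ + u₂, add_mem hu₁ hu₂.1, ?_⟩
  rw [← shift_shift]
  refine ⟨hu₂.2.trans_subset (hsub.trans hneg), hmin₂, fun z hz hz0 =>
    intWeight_pos_of_mem_N hw hmin₂ (fun y hy => ?_) hz hz0⟩
  -- N at the new exponent translates into N at the old one, so minimality of `u₂` becomes
  -- nonnegativity of the weights.
  have h1 := mem_N_shift hu₂ hy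
  rcases le_total (intWeight w (u₂ + y)) (intWeight w u₂) with h | h
  · have := hle h1 h
    rw [intWeight_add] at this
    linarith
  · rw [intWeight_add] at h
    linarith

theorem partialSum_mem_E {β : Fin d → k} {v : Fin n → k} (hβ : applyA A v = β)
    (hneg : nsupp v ⊆ indicesIn A τ) (hint : nonIntegral v ⊆ indicesIn A τ) :
    (QuotientAddGroup.mk (partialSum A τ v) : (Fin d → k) ⧸ latticeOf k A (indicesIn A τ)) ∈
      E A β τ := by
  classical
  refine ⟨partialSum A τ v, ?_, rfl, β - partialSum A τ v, ?_, 0, zero_mem _,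
    (add_zero _).symm⟩
  · refine sum_mem fun j hj => Submodule.smul_mem _ _ (Submodule.subset_span ⟨j, ?_, rfl⟩)
    exact (Finset.mem_filter.1 hj).2
  · have h1 : β - partialSum A τ v = ∑ j with j ∉ indicesIn A τ, v j • col k A j := by
      rw [← hβ, applyA, partialSum, sub_eq_iff_eq_add', ← Finset.sum_filter_add_sum_filter_not
        Finset.univ (fun j => j ∈ indicesIn A τ)]
    rw [h1]
    refine sum_mem fun j hj => ?_
    obtain ⟨e, he⟩ := exists_natCast_of_supports hneg hint (Finset.mem_filter.1 hj).2
    rw [he, Nat.cast_smul_eq_nsmul]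
    exact nsmul_mem (AddSubmonoid.subset_closure (Set.mem_range_self j)) e

/-- Evaluation at the exponent v is 1 on φ_v and 0 on the other series, whose supports lie in other
L-orbits. -/
theorem linearIndependent_phi [CharZero k] (S : Set (Fin n → k))
    (h : ∀ v ∈ S, ∀ v' ∈ S, ∀ u ∈ L A, v' = shift v u → v = v') :
    LinearIndependent k (fun v : S => phi A (v : Fin n → k)) := by
  rw [linearIndependent_iff']
  intro s g hg v hv
  have h1 := congrFun hg (v : Fin n → k)
  rw [Finset.sum_apply, Finset.sum_eq_single v, Pi.smul_apply, phi_self, Pi.zero_apply] at h1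
  · exact (smul_eq_zero.1 h1).resolve_right one_ne_zero
  · intro v' _ hne
    rw [Pi.smul_apply, phi_eq_zero, smul_zero]
    exact fun u hu e => hne (Subtype.ext (h v' v'.2 v v.2 u hu e))
  · exact fun hcon => absurd hv hcon

theorem exists_canonical [CharZero k] {β : Fin d → k} {w : Fin n → ℝ} (hw : IsGeneric k A w)
    (hτ : τ.IsFaceOf (cone A)) (hI : I ∈ regularTriangulation A w)
    (hspan : Submodule.span ℚ (τ : Set (Fin d → ℚ)) =
      Submodule.span ℚ (col ℚ A '' (I : Set (Fin n))))
    {x : Fin d → k} (hx : x ∈ spaceOf k A (indicesIn A τ))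
    {m : Fin d → k} (hm : m ∈ monoidOf k A) {z : Fin d → k}
    (hz : z ∈ latticeOf k A (indicesIn A τ)) (h : β - x = m + z) :
    ∃ v : Fin n → k, vertexSum A I v - x ∈ latticeOf k A (I : Set (Fin n)) ∧
      applyA A v = β ∧ HasMinimalNegativeSupport A v ∧ IsCanonical A β w v (phi A v) ∧
      nsupp v ⊆ (I : Set (Fin n)) ∧ nonIntegral v ⊆ (I : Set (Fin n)) := by
  obtain ⟨v, hβ, hneg, hint, hvx⟩ := exists_applyA_eq hτ hspan hx hm hz h
  obtain ⟨u, hu, hneg', hmin, hpos⟩ := exists_shift_minimal hw hI hneg hint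
  have hint' := (nonIntegral_shift v u).trans_subset hint
  have hβ' := (applyA_shift hu v).trans hβ
  refine ⟨shift v u, ?_, hβ', hmin, ?_, hneg', hint'⟩
  · rw [← sub_add_sub_cancel _ (vertexSum A I v) x]
    exact add_mem (vertexSum_shift_sub_mem v u) hvx
  · exact isCanonical_phi (isHypergeometric_phi hβ' hmin)
      (inDirection_phi hw.1 hmin (isPWO_intWeight_image hI hneg' hint') hpos) hpos

end AHypergeometric

end

/-! ### Counting the exponents -/

open AHypergeometric in
theorem mainTheorem7 {k : Type*} [Field k] [CharZero k] {d n : ℕ}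
    (A : Matrix (Fin d) (Fin n) ℤ)
    (hrank : (A.map (Int.cast : ℤ → ℚ)).rank = d)
    (hA : OnHyperplane A)
    (β : Fin d → k)
    (w : Fin n → ℝ) (hw : IsGeneric k A w)
    (τ : PointedCone ℚ (Fin d → ℚ)) (hτ : τ.IsFaceOf (cone A))
    (I : Finset (Fin n)) (hI : I ∈ regularTriangulation A w)
    (hspan : Submodule.span ℚ (τ : Set (Fin d → ℚ)) =
      Submodule.span ℚ (col ℚ A '' (I : Set (Fin n)))) :
    (E A β τ).Finite ∧
    latticeOf k A (I : Set (Fin n)) ≤ latticeOf k A (indicesIn A τ) ∧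
    (latticeOf k A (I : Set (Fin n))).relIndex (latticeOf k A (indicesIn A τ)) ≠ 0 ∧
    ∃ S : Finset (Fin n → k),
      (E A β τ).ncard *
          (latticeOf k A (I : Set (Fin n))).relIndex (latticeOf k A (indicesIn A τ)) ≤ S.card ∧
      LinearIndependent k (fun v : S => phi A (v : Fin n → k)) ∧
      ∀ v ∈ S,
        applyA A v = β ∧
        HasMinimalNegativeSupport A v ∧
        IsCanonical A β w v (phi A v) ∧
        IsLogFree (phi A v) ∧
        (QuotientAddGroup.mk (partialSum A τ v) :
          (Fin d → k) ⧸ latticeOf k A (indicesIn A τ)) ∈ E A β τ ∧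
        nsupp v ⊆ (I : Set (Fin n)) ∧
        nonIntegral v ⊆ (I : Set (Fin n)) := by
  classical
  have hsub := subset_indicesIn hτ hspan
  have hle : latticeOf k A (I : Set (Fin n)) ≤ latticeOf k A (indicesIn A τ) :=
    AddSubgroup.closure_mono (Set.image_mono hsub)
  have hEfin := finite_E β hτ hspan
  have : Finite (latticeOf k A (indicesIn A τ) ⧸
      (latticeOf k A (I : Set (Fin n))).addSubgroupOf (latticeOf k A (indicesIn A τ))) :=
    finite_latticeOf_quotient (col_mem_span_of_mem_indicesIn hspan)
  have : Finite (E A β τ) := hEfin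
  refine ⟨hEfin, hle, AddSubgroup.index_ne_zero_of_finite, ?_⟩
  set ι := E A β τ × (latticeOf k A (indicesIn A τ) ⧸
      (latticeOf k A (I : Set (Fin n))).addSubgroupOf (latticeOf k A (indicesIn A τ)))
  have : Fintype ι := Fintype.ofFinite ι
  choose l hl hlq m hm z hz hlmz using fun q : E A β τ => q.2
  -- One target vertex part for each pair: a lift of the class in E_τ(β) plus a coset
  -- representative. The class modulo ℤF recovers the first entry, then the class modulo ℤI the
  -- second.
  set x : ι → Fin d → k := fun i => l i.1 + (i.2.out : Fin d → k) with hx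
  have hxinj : ∀ i i', x i - x i' ∈ latticeOf k A (I : Set (Fin n)) → i = i' := by
    rintro ⟨q, g⟩ ⟨q', g'⟩ h
    have h1 : l q - l q' ∈ latticeOf k A (indicesIn A τ) := by
      have := sub_mem (hle h) (sub_mem g.out.2 g'.out.2)
      convert this using 1
      simp only [hx]
      abel
    obtain rfl : q = q' := by
      refine Subtype.ext ?_
      rw [← hlq q, ← hlq q', QuotientAddGroup.eq_iff_sub_mem]
      exact h1
    have h2 : (g.out : Fin d → k) - g'.out ∈ latticeOf k A (I : Set (Fin n)) := by
      simpa [hx] using h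
    obtain rfl : g = g' := by
      rw [← QuotientAddGroup.out_eq' g, ← QuotientAddGroup.out_eq' g',
        QuotientAddGroup.eq_iff_sub_mem, AddSubgroup.mem_addSubgroupOf]
      exact h2
    rfl
  -- The coset representative added to the lift is absorbed by subtracting it from `z`.
  have hex := fun i : ι => exists_canonical (β := β) hw hτ hI hspan (x := x i)
    (add_mem (hl i.1) (latticeOf_le_spaceOf _ i.2.out.2)) (hm i.1)
    (sub_mem (hz i.1) i.2.out.2)
    (by rw [hx, ← sub_sub, hlmz, add_sub_assoc])
  choose v hvx hv using hex
  have hvinj : ∀ i i', ∀ u ∈ L A, v i' = shift (v i) u → i = i' := by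
    intro i i' u _ h
    refine (hxinj i' i ?_).symm
    have h1 := vertexSum_shift_sub_mem (A := A) (I := I) (v i) u
    rw [← h] at h1
    have h2 := sub_mem (add_mem h1 (hvx i)) (hvx i')
    convert h2 using 1
    abel
  have hinj : Function.Injective v := fun i i' h =>
    hvinj i i' 0 (zero_mem _) (by rw [shift_zero, h])
  refine ⟨Finset.univ.image v, ?_, ?_, ?_⟩
  · rw [Finset.card_image_of_injective _ hinj, Finset.card_univ, ← Nat.card_eq_fintype_card,
      Nat.card_prod]
    rfl
  · refine linearIndependent_phi (k := k) (A := A) (Finset.univ.image v : Finset (Fin n → k)) ?_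
    intro a ha b hb u hu hab
    obtain ⟨i, -, rfl⟩ := Finset.mem_image.1 (Finset.mem_coe.1 ha)
    obtain ⟨i', -, rfl⟩ := Finset.mem_image.1 (Finset.mem_coe.1 hb)
    rw [hvinj i i' u hu hab]
  · intro a ha
    obtain ⟨i, -, rfl⟩ := Finset.mem_image.1 ha
    obtain ⟨h1, h2, h3, h4, h5⟩ := hv i
    exact ⟨h1, h2, h3, isLogFree_phi A _,
      partialSum_mem_E h1 (h4.trans hsub) (h5.trans hsub), h4, h5⟩
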